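/- Let $\mathcal N$ be a von Neumann algebra acting on a separable complex Hilbert space $\mathcal H$, with a fixed faithful normal semifinite trace $\tau$. Let $\mathcal K$ be the norm-closed two-sided ideal of $\mathcal N$ generated by the projections of finite trace, and let $\pi:\mathcal N\to\mathcal N/\mathcal K$ be the quotient map ($\mathcal N/\mathcal K$ carries the quotient norm). Let $\mathcal F^{sa}$ be the set of self-adjoint $T\in\mathcal N$ such that $\pi(T)$ is invertible (the self-adjoint $\tau$-Fredholm operators), with the norm topology. For projections $P,Q\in\mathcal N$ an operator $T\in P\mathcal NQ$ is called $(P\cdot Q)$ $\tau$-Fredholm if the projections $[\ker T\cap Q(\mathcal H)]$ and $[\ker T^*\cap P(\mathcal H)]$ onto these subspaces have finite trace and there is a projection $P_1\le P$ in $\mathcal N$ with $\tau(P-P_1)<\infty$ and $P_1(\mathcal H)\subseteq T(\mathcal H)$; its index is then $$\mathrm{Ind}_{(P\cdot Q)}(T)=\tau[\ker T\cap Q(\mathcal H)]-\tau[\ker T^*\cap P(\mathcal H)].$$ For projections with $\|\pi(P)-\pi(Q)\|<1$ the essential codimension is $ec(P,Q)=\mathrm{Ind}_{(P\cdot Q)}(PQ)$.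 Let $\chi$ be the characteristic function of $[0,\infty)$. For a continuous path $\{B_t\}_{t\in[0,1]}$ in $\mathcal F^{sa}$ choose a partition $0=t_0<t_1<\dots<t_k=1$ such that $\|\pi(\chi(B_r))-\pi(\chi(B_s))\|<\tfrac12$ for all $r,s\in[t_{i-1},t_i]$, $i=1,\dots,k$, and put $$sf(\{B_t\})=\sum_{i=1}^k ec\bigl(\chi(B_{t_{i-1}}),\chi(B_{t_i})\bigr).$$ **Proposition.** Spectral flow is homotopy invariant: let $\{B_t\}$ and $\{B'_t\}$ be continuous paths in $\mathcal F^{sa}$ with $B_0=B'_0$ and $B_1=B'_1$ which are homotopic in $\mathcal F^{sa}$ via a homotopy leaving the endpoints fixed. Then the spectral flows of both paths are well defined (such partitions exist, the operators $\chi(B_{t_{i-1}})\chi(B_{t_i})$ are $\tau$-Fredholm, and the sum does not depend on the partition), and $sf(\{B_t\})=sf(\{B'_t\})$. -/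

import Mathlib

open scoped NNReal ENNReal

noncomputable section

namespace SpectralFlow

variable {H : Type*} [NormedAddCommGroup H] [InnerProductSpace ℂ H] [CompleteSpace H]

/-- A von Neumann algebra is stable under complex scalars; this makes `↥N` a normed algebra. -/
instance : SMulMemClass (VonNeumannAlgebra H) ℂ (H →L[ℂ] H) where
  smul_mem {S} c _ hx := S.toStarSubalgebra.smul_mem hx c

/-- A faithful normal semifinite trace on a von Neumann algebra `N`. The order on `N` is the order
of operators (`S ≤ T` iff `T - S` is a positive operator). A trace is a `[0, ∞]`-valued function on
the positive cone `{T : N | 0 ≤ T}`; the values of `toFun` outside of the cone carry no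
information, and they are never used. -/
structure FNSTrace (N : VonNeumannAlgebra H) where
  toFun : N → ℝ≥0∞
  map_add : ∀ S T : N, 0 ≤ S → 0 ≤ T → toFun (S + T) = toFun S + toFun T
  map_smul : ∀ (c : ℝ≥0) (S : N), 0 ≤ S → toFun (((c : ℝ) : ℂ) • S) = (c : ℝ≥0∞) * toFun S
  /-- the trace property -/
  map_star_mul_self : ∀ T : N, toFun (star T * T) = toFun (T * star T)
  faithful : ∀ S : N, 0 ≤ S → toFun S = 0 → S = 0
  /-- `τ (sup F) = sup τ(F)` for every upward directed family `F` of positive elements of `N` -/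
  normal : ∀ (F : Set N) (S : N), F.Nonempty → DirectedOn (· ≤ ·) F → (∀ T ∈ F, 0 ≤ T) →
    IsLUB F S → IsLUB (toFun '' F) (toFun S)
  semifinite : ∀ S : N, 0 ≤ S →
    IsLUB (toFun '' {T : N | 0 ≤ T ∧ T ≤ S ∧ toFun T < ∞}) (toFun S)

variable {N : VonNeumannAlgebra H}

instance : CoeFun (FNSTrace N) (fun _ => N → ℝ≥0∞) := ⟨FNSTrace.toFun⟩

/-! ### The Calkin algebra -/

/-- The closure of a two-sided ideal of a topological ring is two-sided. -/
instance closure_isTwoSided {R : Type*} [Ring R] [TopologicalSpace R] [IsTopologicalRing R]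
    (I : Ideal R) [I.IsTwoSided] : I.closure.IsTwoSided where
  mul_mem_of_left b ha :=
    map_mem_closure (f := fun x => x * b) (continuous_mul_const b) ha
      fun _ hx => I.mul_mem_right b hx

/-- `𝓚`: the norm-closed two-sided ideal of `N` generated by the `τ`-finite projections. -/
def compactIdeal (τ : FNSTrace N) : Ideal N :=
  (TwoSidedIdeal.asIdeal (TwoSidedIdeal.span {p : N | IsStarProjection p ∧ τ p < ∞})).closure

instance (τ : FNSTrace N) : (compactIdeal τ).IsTwoSided :=
  inferInstanceAs (Ideal.closure _).IsTwoSided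

/-- The generalized Calkin algebra `N ⧸ 𝓚`, with its quotient ring structure and (below) with its
quotient norm. -/
abbrev Calkin (τ : FNSTrace N) : Type _ := N ⧸ compactIdeal τ

/-- The quotient norm `‖π(T)‖ = inf {‖T + K‖ : K ∈ 𝓚}`. -/
instance (τ : FNSTrace N) : SeminormedAddCommGroup (Calkin τ) :=
  Submodule.Quotient.seminormedAddCommGroup (compactIdeal τ)

/-- The Calkin map `π : N → N ⧸ 𝓚`. -/
def calkinMap (τ : FNSTrace N) : N →+* Calkin τ := Ideal.Quotient.mk (compactIdeal τ)

/-- `𝓕^{sa}`: the self-adjoint `τ`-Fredholm operators of `N`, i.e. the self-adjoint `T ∈ N` for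
which `π(T)` is invertible. Its topology is the one of the operator norm. -/
def selfAdjointFredholm (τ : FNSTrace N) : Set N :=
  {T : N | IsSelfAdjoint T ∧ IsUnit (calkinMap τ T)}

/-! ### Projections onto subspaces -/

/-- `[S]`: the orthogonal projection onto the closure of the subspace `S`. -/
def proj (S : Submodule ℂ H) : H →L[ℂ] H := S.topologicalClosure.starProjection

/-- The projection onto the closure of a subspace that is invariant under the commutant of `N`
belongs to `N`. -/
theorem proj_mem (N : VonNeumannAlgebra H) (S : Submodule ℂ H)
    (hS : ∀ y ∈ N.commutant, ∀ x ∈ S, y x ∈ S) : proj S ∈ N := by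
  have hp : IsStarProjection (proj S) := isStarProjection_starProjection
  rw [VonNeumannAlgebra.IsStarProjection.mem_iff hp]
  intro y hy
  have hr : (proj S).range = S.topologicalClosure := Submodule.range_starProjection _
  rw [hr, Module.End.mem_invtSubmodule]
  intro x hx
  exact map_mem_closure y.continuous hx fun z hz => hS y hy z hz

theorem commutant_apply {y : H →L[ℂ] H} (hy : y ∈ N.commutant) (T : N) (x : H) :
    y ((T : H →L[ℂ] H) x) = (T : H →L[ℂ] H) (y x) := by
  have h := VonNeumannAlgebra.mem_commutant_iff.1 hy T T.2
  exact (DFunLike.congr_fun h x).symm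

/-- `[ker_Q(T)]`, the projection onto `ker(T) ∩ Q(H)`, as an element of `N`. -/
def kerProj (Q T : N) : N :=
  ⟨proj ((T : H →L[ℂ] H).ker ⊓ (Q : H →L[ℂ] H).range), proj_mem N _ (by
    rintro y hy x ⟨hx, z, rfl⟩
    refine ⟨?_, y z, (commutant_apply hy Q z).symm⟩
    have hx' : (T : H →L[ℂ] H) ((Q : H →L[ℂ] H) z) = 0 := hx
    change (T : H →L[ℂ] H) (y ((Q : H →L[ℂ] H) z)) = 0
    rw [← commutant_apply hy, hx', map_zero])⟩

/-- `χ(T)` for a self-adjoint `T ∈ N`, where `χ` is the characteristic function of `[0, ∞)`: the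
spectral projection of `T` for `[0, ∞)`. As `[0, ∞)` is the zero set of the continuous function
`r ↦ max (-r) 0`, this is the projection onto the kernel of the negative part
`T⁻ = max (-T) 0` of `T`. -/
def chi (T : N) : N :=
  ⟨proj (cfc (fun r : ℝ => max (-r) 0) (T : H →L[ℂ] H)).ker, proj_mem N _ (by
    intro y hy x hx
    by_cases hT : IsSelfAdjoint (T : H →L[ℂ] H)
    · have hc : Commute (T : H →L[ℂ] H) y := VonNeumannAlgebra.mem_commutant_iff.1 hy T T.2
      have h := DFunLike.congr_fun (hc.cfc_real (fun r : ℝ => max (-r) 0)).eq x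
      have hx' : cfc (fun r : ℝ => max (-r) 0) (T : H →L[ℂ] H) x = 0 := hx
      change cfc (fun r : ℝ => max (-r) 0) (T : H →L[ℂ] H) (y x) = 0
      refine h.trans ?_
      change y (cfc (fun r : ℝ => max (-r) 0) (T : H →L[ℂ] H) x) = 0
      rw [hx', map_zero]
    · rw [cfc_apply_of_not_predicate _ hT]
      rfl)⟩

/-! ### Fredholm operators in a skew corner, index, essential codimension -/

/-- `T` is a `(P·Q)` `τ`-Fredholm operator (for projections `P`, `Q` of `N`): `T ∈ P N Q`, the
projections onto `ker(T) ∩ Q(H)` and `ker(T*) ∩ P(H)` are `τ`-finite, and there is a projection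
`P₁ ≤ P` of `N` with `P - P₁` `τ`-finite and `P₁(H) ⊆ T(H)`. -/
structure IsFredholm (τ : FNSTrace N) (P Q T : N) : Prop where
  mem_corner : P * T * Q = T
  finite_ker : τ (kerProj Q T) < ∞
  finite_ker_star : τ (kerProj P (star T)) < ∞
  exists_range_le : ∃ P₁ : N, IsStarProjection P₁ ∧ P₁ ≤ P ∧ τ (P - P₁) < ∞ ∧
    (P₁ : H →L[ℂ] H).range ≤ (T : H →L[ℂ] H).range

/-- The `(P·Q)`-index `τ[ker_Q(T)] - τ[ker_P(T*)]` of a `(P·Q)` `τ`-Fredholm operator `T`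
(both traces are then finite). -/
def index (τ : FNSTrace N) (P Q T : N) : ℝ :=
  (τ (kerProj Q T)).toReal - (τ (kerProj P (star T))).toReal

/-- The essential codimension `ec(P, Q)`: the `(P·Q)`-index of `PQ`, for projections with
`‖π(P) - π(Q)‖ < 1`. -/
def ec (τ : FNSTrace N) (P Q : N) : ℝ := index τ P Q (P * Q)

/-! ### Spectral flow -/

/-- A partition `0 = t₀ < t₁ < ⋯ < t_k = 1` such that `‖π(χ(B_r)) - π(χ(B_s))‖ < 1/2` for all
`r, s` in the same subinterval `[t_{i-1}, t_i]`. -/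
structure Partition (τ : FNSTrace N) {B₀ B₁ : selfAdjointFredholm τ} (B : Path B₀ B₁) where
  k : ℕ
  t : Fin (k + 1) → unitInterval
  strictMono : StrictMono t
  first : t 0 = 0
  last : t (Fin.last k) = 1
  close : ∀ i : Fin k, ∀ r ∈ Set.Icc (t i.castSucc) (t i.succ),
    ∀ s ∈ Set.Icc (t i.castSucc) (t i.succ),
      ‖calkinMap τ (chi (B r : N)) - calkinMap τ (chi (B s : N))‖ < 1 / 2

variable {τ : FNSTrace N} {B₀ B₁ : selfAdjointFredholm τ}

/-- The projection `P_i = χ(B_{t_i})`. -/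
def Partition.P {B : Path B₀ B₁} (p : Partition τ B) (i : Fin (p.k + 1)) : N := chi (B (p.t i) : N)

/-- The sum of the essential codimensions `ec(P_{i-1}, P_i)`, `i = 1, …, k`. -/
def Partition.sumEc {B : Path B₀ B₁} (p : Partition τ B) : ℝ :=
  ∑ i : Fin p.k, ec τ (p.P i.castSucc) (p.P i.succ)

/-- The definition of the spectral flow of `B` makes sense: there is a partition as required, the
operators whose indices are taken are `τ`-Fredholm, and the sum of the essential codimensions does
not depend on the partition. -/
structure WellDefined (τ : FNSTrace N) {B₀ B₁ : selfAdjointFredholm τ} (B : Path B₀ B₁) :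
    Prop where
  exists_partition : Nonempty (Partition τ B)
  fredholm : ∀ (p : Partition τ B) (i : Fin p.k),
    IsFredholm τ (p.P i.castSucc) (p.P i.succ) (p.P i.castSucc * p.P i.succ)
  sum_eq : ∀ p q : Partition τ B, p.sumEc = q.sumEc

open Classical in
/-- The spectral flow of a continuous path in `𝓕^{sa}`: the sum of the essential codimensions
along a partition as above (with the conventional value `0` should there be no such partition). -/
def sf (τ : FNSTrace N) {B₀ B₁ : selfAdjointFredholm τ} (B : Path B₀ B₁) : ℝ :=
  if h : Nonempty (Partition τ B) then h.some.sumEc else 0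

end SpectralFlow

end

/-!
Homotopy invariance of spectral flow rests on two facts about the pairs `(P, Q)` of projections of
`N` with `‖π(P) - π(Q)‖ < 1/2`: the cocycle identity `ec(P, Q) + ec(Q, R) = ec(P, R)` for three
such projections (`ec_add_ec`), and the continuity of `T ↦ π(χ(T))` on `𝓕^{sa}`
(`continuous_calkinMap_chi`). Given these, the sum of essential codimensions over a partition,
cut off at `s`, is as a function of `s` determined up to a locally constant function
(`Partition.sumEc_eq`), and along a homotopy the sums over one fine uniform partition are locally
constant, because their differences telescope (`sf_eq_of_homotopy`).

All index theory is done with the dimension `τ[S]` of subspaces `S` of `H` that are affiliated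
with `N`, i.e. invariant under its commutant. Everything about `τ` beyond additivity and
monotonicity is contained in one comparison principle (`dim_le_dim`): if `T ∈ N` maps no nonzero
vector of the closed subspace `S` into the complement of `S'`, then `dim S ≤ dim S'`. It follows
from `τ[X*H] ≤ τ[XH]` (`dim_range_star_le`), which is where normality and the trace property are
used: the contractions `c_n = X (X*X + 1/(n+1))^{-1/2}` satisfy `c_n* c_n ↑ [X*H]`, while
`c_n c_n* ≤ [XH]`.

A bound on a norm in the Calkin algebra is a bound on the complement of a `τ`-finite subspace
(`exists_isFinite_of_norm_calkinMap_lt`), since the operators that vanish on such a complement form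
a two-sided ideal. An operator `T ∈ P N Q` that is bounded below on a closed subspace `M` of finite
codimension in `Q(H)`, with `T(M)` of finite codimension in `P(H)`, is Fredholm, and its index is
the difference of these codimensions (`isFredholm_and_index_eq`). For the cocycle identity the
formula is applied on one `M ≤ R(H)` to `PR` and `QR`, and on `Q(M)` to `PQ`; it remains to see
that `P(M)` and `PQ(M)` have the same codimension in `P(H)`, which holds because `Pm` and `PQm`
are never orthogonal for `0 ≠ m ∈ M`.

For the continuity, a self-adjoint Fredholm operator `T₀` is bounded below on the complement of a
`τ`-finite subspace, and so are all `T` near `T₀`, with the same subspace and a common bound. Hence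
their spectral subspaces for `(-δ, 0)` are `τ`-finite for a common `δ`, and `π(χ(T)) = π(f(T))` for
a fixed continuous function `f` (`softStep_sub_chi_mem`).
-/

open scoped NNReal ENNReal

noncomputable section

namespace SpectralFlow

open Filter Topology

set_option linter.unusedSectionVars false

variable {H : Type*} [NormedAddCommGroup H] [InnerProductSpace ℂ H] [CompleteSpace H]
variable {N : VonNeumannAlgebra H} {τ : FNSTrace N}

/-! ### Affiliated subspaces -/

/-- A (not necessarily closed) subspace is affiliated with `N` if it is invariant under the
commutant of `N`. For such `S` the projection `proj S` onto its closure lies in `N`. -/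
def IsAffiliated (N : VonNeumannAlgebra H) (S : Submodule ℂ H) : Prop :=
  ∀ y ∈ N.commutant, ∀ x ∈ S, y x ∈ S

theorem inner_star_apply (T : N) (x y : H) :
    inner ℂ (((star T : N) : H →L[ℂ] H) x) y = inner ℂ x ((T : H →L[ℂ] H) y) := by
  change inner ℂ ((star (T : H →L[ℂ] H)) x) y = _
  rw [ContinuousLinearMap.star_eq_adjoint, ContinuousLinearMap.adjoint_inner_left]

theorem inner_apply_star (T : N) (x y : H) :
    inner ℂ x (((star T : N) : H →L[ℂ] H) y) = inner ℂ ((T : H →L[ℂ] H) x) y := by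
  have h := inner_star_apply (star T) x y
  rw [star_star] at h
  exact h.symm

namespace IsAffiliated

theorem proj_mem {S : Submodule ℂ H} (hS : IsAffiliated N S) : proj S ∈ N :=
  SpectralFlow.proj_mem N S hS

theorem inf {S S' : Submodule ℂ H} (hS : IsAffiliated N S) (hS' : IsAffiliated N S') :
    IsAffiliated N (S ⊓ S') :=
  fun y hy x hx => ⟨hS y hy x hx.1, hS' y hy x hx.2⟩

theorem sup {S S' : Submodule ℂ H} (hS : IsAffiliated N S) (hS' : IsAffiliated N S') :
    IsAffiliated N (S ⊔ S') := by
  intro y hy x hx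
  obtain ⟨a, ha, b, hb, rfl⟩ := Submodule.mem_sup.1 hx
  rw [map_add]
  exact Submodule.add_mem_sup (hS y hy a ha) (hS' y hy b hb)

theorem orthogonal {S : Submodule ℂ H} (hS : IsAffiliated N S) : IsAffiliated N Sᗮ := by
  intro y hy x hx
  rw [Submodule.mem_orthogonal] at hx ⊢
  intro u hu
  rw [← ContinuousLinearMap.adjoint_inner_left]
  exact hx _ (hS _ (star_mem hy) u hu)

theorem topologicalClosure {S : Submodule ℂ H} (hS : IsAffiliated N S) :
    IsAffiliated N S.topologicalClosure :=
  fun y hy _ hx => map_mem_closure y.continuous hx fun z hz => hS y hy z hz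

theorem map {S : Submodule ℂ H} (hS : IsAffiliated N S) (T : N) :
    IsAffiliated N (S.map (T : H →L[ℂ] H).toLinearMap) := by
  rintro y hy _ ⟨z, hz, rfl⟩
  exact ⟨y z, hS y hy z hz, (commutant_apply hy T z).symm⟩

theorem comap {S : Submodule ℂ H} (hS : IsAffiliated N S) (T : N) :
    IsAffiliated N (S.comap (T : H →L[ℂ] H).toLinearMap) := by
  intro y hy x hx
  change (T : H →L[ℂ] H) (y x) ∈ S
  rw [← commutant_apply hy]
  exact hS y hy _ hx

theorem range (T : N) : IsAffiliated N (T : H →L[ℂ] H).range := by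
  rintro y hy _ ⟨z, rfl⟩
  exact ⟨y z, (commutant_apply hy T z).symm⟩

theorem ker (T : N) : IsAffiliated N (T : H →L[ℂ] H).ker := by
  intro y hy x hx
  have hx' : (T : H →L[ℂ] H) x = 0 := hx
  change (T : H →L[ℂ] H) (y x) = 0
  rw [← commutant_apply hy, hx', map_zero]

theorem bot : IsAffiliated N (⊥ : Submodule ℂ H) := by
  intro y _ x hx
  rw [Submodule.mem_bot] at hx ⊢
  rw [hx, map_zero]

end IsAffiliated

/-! ### The projection onto the closure of a subspace -/

theorem proj_apply_mem (S : Submodule ℂ H) (x : H) : proj S x ∈ S.topologicalClosure :=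
  Submodule.starProjection_apply_mem _ x

theorem proj_apply_of_mem {S : Submodule ℂ H} {x : H} (hx : x ∈ S) : proj S x = x :=
  Submodule.starProjection_eq_self_iff.2 (S.le_topologicalClosure hx)

theorem sub_proj_apply_mem (S : Submodule ℂ H) (x : H) : x - proj S x ∈ Sᗮ := by
  rw [← Submodule.orthogonal_closure]
  exact Submodule.sub_starProjection_mem_orthogonal x

theorem proj_apply_eq_zero_iff {S : Submodule ℂ H} {x : H} : proj S x = 0 ↔ x ∈ Sᗮ := by
  rw [proj, Submodule.starProjection_apply_eq_zero_iff, Submodule.orthogonal_closure]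

theorem isStarProjection_proj (S : Submodule ℂ H) : IsStarProjection (proj S) :=
  isStarProjection_starProjection

theorem re_inner_proj (S : Submodule ℂ H) (x : H) :
    RCLike.re (inner ℂ (proj S x) x) = ‖proj S x‖ ^ 2 :=
  Submodule.re_inner_starProjection_eq_normSq _ x

theorem proj_mono {S S' : Submodule ℂ H} (h : S ≤ S'.topologicalClosure) : proj S ≤ proj S' := by
  rw [proj, proj, Submodule.starProjection_le_starProjection_iff]
  exact Submodule.topologicalClosure_minimal _ h S'.isClosed_topologicalClosure

/-- A vector of `B` that is orthogonal to the complement in `B` of a closed subspace `A ≤ B`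
lies in `A`. -/
theorem mem_of_forall_inner_eq_zero {A B : Submodule ℂ H} (hA : IsClosed (A : Set H)) (hAB : A ≤ B)
    {x : H} (hx : x ∈ B) (h : x ∈ (B ⊓ Aᗮ)ᗮ) : x ∈ A := by
  have hcl : proj A x ∈ A := by
    have := proj_apply_mem A x
    rwa [hA.submodule_topologicalClosure_eq] at this
  have h1 : x - proj A x ∈ Aᗮ := sub_proj_apply_mem A x
  have h2 : x - proj A x ∈ B ⊓ Aᗮ := ⟨B.sub_mem hx (hAB hcl), h1⟩
  have h3 : inner ℂ (x - proj A x) x = 0 := (Submodule.mem_orthogonal _ _).1 h _ h2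
  have h4 : inner ℂ (x - proj A x) (proj A x) = 0 := Submodule.inner_left_of_mem_orthogonal hcl h1
  have h5 : inner ℂ (x - proj A x) (x - proj A x) = 0 := by rw [inner_sub_right, h3, h4, sub_zero]
  rw [inner_self_eq_zero, sub_eq_zero] at h5
  rw [h5]; exact hcl

/-- A projection of `N` is the projection onto its range. -/
theorem proj_range {p : N} (hp : IsStarProjection p) :
    proj (p : H →L[ℂ] H).range = (p : H →L[ℂ] H) := by
  have hp' : IsStarProjection (p : H →L[ℂ] H) :=
    ⟨congrArg Subtype.val hp.isIdempotentElem.eq, congrArg Subtype.val hp.isSelfAdjoint.star_eq⟩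
  obtain ⟨i, hi⟩ := isStarProjection_iff_eq_starProjection_range.1 hp'
  have hc : IsClosed ((p : H →L[ℂ] H).range : Set H) := by
    rw [← Submodule.orthogonal_orthogonal (p : H →L[ℂ] H).range]
    exact Submodule.isClosed_orthogonal _
  rw [hi]
  simp only [Submodule.range_starProjection, proj]
  congr 1
  exact hc.submodule_topologicalClosure_eq

theorem isClosed_range {p : N} (hp : IsStarProjection p) :
    IsClosed ((p : H →L[ℂ] H).range : Set H) := by
  rw [← proj_range hp, proj, Submodule.range_starProjection]
  exact Submodule.isClosed_topologicalClosure _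

/-! ### The trace dimension of a subspace -/

open Classical in
/-- The dimension `τ[S]` of an affiliated subspace `S`, that is, the trace of the projection onto
its closure. (It is `0` by convention if that projection is not in `N`.) -/
def dim (τ : FNSTrace N) (S : Submodule ℂ H) : ℝ≥0∞ :=
  if h : proj S ∈ N then τ ⟨proj S, h⟩ else 0

theorem dim_eq {S : Submodule ℂ H} (h : proj S ∈ N) : dim τ S = τ ⟨proj S, h⟩ := dif_pos h

theorem dim_range {p : N} (hp : IsStarProjection p) : dim τ (p : H →L[ℂ] H).range = τ p := by
  have h := proj_range hp
  rw [dim_eq (by rw [h]; exact p.2)]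
  congr 1
  exact Subtype.ext h

theorem dim_topologicalClosure {S : Submodule ℂ H} : dim τ S.topologicalClosure = dim τ S := by
  have h : proj S.topologicalClosure = proj S := by
    simp only [proj]
    congr 1
    exact S.isClosed_topologicalClosure.submodule_topologicalClosure_eq
  by_cases hN : proj S ∈ N
  · rw [dim_eq hN, dim_eq (h ▸ hN)]
    congr 1
    exact Subtype.ext h
  · rw [dim, dim, dif_neg hN, dif_neg (h ▸ hN)]

theorem FNSTrace.mono (τ : FNSTrace N) {S T : N} (hS : 0 ≤ S) (hST : S ≤ T) : τ S ≤ τ T := by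
  have h := τ.map_add S (T - S) hS (sub_nonneg.2 hST)
  rw [add_sub_cancel] at h
  rw [h]; exact le_self_add

theorem proj_nonneg (S : Submodule ℂ H) : 0 ≤ proj S := (isStarProjection_proj S).nonneg

theorem dim_mono {S S' : Submodule ℂ H} (hS : IsAffiliated N S) (hS' : IsAffiliated N S')
    (h : S ≤ S'.topologicalClosure) : dim τ S ≤ dim τ S' := by
  rw [dim_eq hS.proj_mem, dim_eq hS'.proj_mem]
  exact τ.mono (proj_nonneg S) (proj_mono h)

theorem proj_eq_add {A B : Submodule ℂ H} (hB : IsClosed (B : Set H)) (hAB : A ≤ B) :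
    proj B = proj A + proj (B ⊓ Aᗮ) := by
  ext x
  have hAx : proj A x ∈ B := by
    refine Submodule.topologicalClosure_minimal A hAB hB (proj_apply_mem A x)
  have hBx : proj B x ∈ B := by
    have := proj_apply_mem B x
    rwa [hB.submodule_topologicalClosure_eq] at this
  have hB' := sub_proj_apply_mem B x
  have hmem : proj B x - proj A x ∈ B ⊓ Aᗮ := by
    refine ⟨B.sub_mem hBx hAx, ?_⟩
    have h : proj B x - proj A x = (x - proj A x) - (x - proj B x) := by abel
    rw [h]
    exact Aᗮ.sub_mem (sub_proj_apply_mem A x) (Submodule.orthogonal_le hAB hB')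
  have horth : x - (proj B x - proj A x) ∈ (B ⊓ Aᗮ)ᗮ := by
    have h : x - (proj B x - proj A x) = (x - proj B x) + proj A x := by abel
    rw [h]
    refine Submodule.add_mem _ (Submodule.orthogonal_le inf_le_left hB') ?_
    refine Submodule.orthogonal_le inf_le_right ?_
    rw [Submodule.orthogonal_orthogonal_eq_closure]
    exact proj_apply_mem A x
  have h1 := proj_apply_of_mem hmem
  have h2 := proj_apply_eq_zero_iff.2 horth
  rw [map_sub, h1, sub_eq_zero] at h2
  rw [add_apply, h2]
  abel

theorem dim_eq_add {A B : Submodule ℂ H} (hA : IsAffiliated N A) (hB : IsAffiliated N B)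
    (hBc : IsClosed (B : Set H)) (hAB : A ≤ B) :
    dim τ B = dim τ A + dim τ (B ⊓ Aᗮ) := by
  rw [dim_eq hA.proj_mem, dim_eq hB.proj_mem, dim_eq (hB.inf hA.orthogonal).proj_mem,
    ← τ.map_add _ _ (proj_nonneg A) (proj_nonneg _)]
  congr 1
  exact Subtype.ext (proj_eq_add hBc hAB)

/-! ### Comparison of dimensions -/

theorem cfc_mem (T : N) (f : ℝ → ℝ) : cfc f (T : H →L[ℂ] H) ∈ N := by
  have h : cfc f (T : H →L[ℂ] H) ∈ N.commutant.commutant := by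
    rw [VonNeumannAlgebra.mem_commutant_iff]
    intro y hy
    have hc : Commute (T : H →L[ℂ] H) y := VonNeumannAlgebra.mem_commutant_iff.1 hy T T.2
    exact (hc.cfc_real f).symm.eq
  rwa [N.commutant_commutant] at h

theorem le_of_re_inner_le {S T : H →L[ℂ] H} (hS : IsSelfAdjoint S) (hT : IsSelfAdjoint T)
    (h : ∀ x, RCLike.re (inner ℂ (S x) x) ≤ RCLike.re (inner ℂ (T x) x)) : S ≤ T := by
  rw [ContinuousLinearMap.le_def, ContinuousLinearMap.isPositive_def]
  refine ⟨(hT.sub hS).isSymmetric, fun x => ?_⟩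
  rw [ContinuousLinearMap.reApplyInnerSelf_apply, sub_apply, inner_sub_left, map_sub]
  exact sub_nonneg.2 (h x)

theorem re_inner_le_of_le {S T : H →L[ℂ] H} (h : S ≤ T) (x : H) :
    RCLike.re (inner ℂ (S x) x) ≤ RCLike.re (inner ℂ (T x) x) := by
  rw [ContinuousLinearMap.le_def, ContinuousLinearMap.isPositive_def] at h
  have h2 := h.2 x
  rw [ContinuousLinearMap.reApplyInnerSelf_apply, sub_apply, inner_sub_left, map_sub] at h2
  exact sub_nonneg.1 h2

theorem re_inner_star_mul_self (c : N) (x : H) :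
    RCLike.re (inner ℂ (((star c * c : N) : H →L[ℂ] H) x) x) = ‖(c : H →L[ℂ] H) x‖ ^ 2 := by
  change RCLike.re (inner ℂ (((star c : N) : H →L[ℂ] H) ((c : H →L[ℂ] H) x)) x) = _
  rw [inner_star_apply, inner_self_eq_norm_sq]

theorem star_apply_eq_zero_iff {X : N} {x : H} :
    ((star X : N) : H →L[ℂ] H) x = 0 ↔ x ∈ ((X : H →L[ℂ] H).range)ᗮ := by
  rw [Submodule.mem_orthogonal]
  constructor
  · rintro h _ ⟨z, rfl⟩
    change inner ℂ ((X : H →L[ℂ] H) z) x = 0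
    rw [← inner_apply_star, h, inner_zero_right]
  · intro h
    rw [← inner_self_eq_zero (𝕜 := ℂ), inner_apply_star]
    exact h _ ⟨_, rfl⟩

/-- If the range of `c` is contained in the one of `X` and `c` is a contraction, then
`c c*` is dominated by the projection onto the closure of the range of `X`. -/
theorem mul_star_self_le_proj {X c : N} (hX : (c : H →L[ℂ] H).range ≤ (X : H →L[ℂ] H).range)
    (hc : ‖(c : H →L[ℂ] H)‖ ≤ 1) : ((c * star c : N) : H →L[ℂ] H) ≤ proj (X : H →L[ℂ] H).range := by
  refine le_of_re_inner_le (congrArg Subtype.val (IsSelfAdjoint.mul_star_self c).star_eq)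
    (isStarProjection_proj _).isSelfAdjoint fun x => ?_
  have h := re_inner_star_mul_self (star c) x
  rw [star_star] at h
  rw [h, re_inner_proj]
  have h0 : ((star c : N) : H →L[ℂ] H) (x - proj (X : H →L[ℂ] H).range x) = 0 :=
    star_apply_eq_zero_iff.2 (Submodule.orthogonal_le hX (sub_proj_apply_mem _ x))
  rw [map_sub, sub_eq_zero] at h0
  rw [h0]
  have hn : ‖((star c : N) : H →L[ℂ] H)‖ ≤ 1 := (norm_star (c : H →L[ℂ] H)).trans_le hc
  gcongr
  exact ContinuousLinearMap.le_of_opNorm_le_of_le _ hn le_rfl |>.trans_eq (one_mul _)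

/-- The function `r ↦ (|r| + 1/(n+1))^{-1/2}`; the absolute value makes it continuous on all
of `ℝ`. -/
def invSqrt (n : ℕ) (r : ℝ) : ℝ := (Real.sqrt (|r| + 1 / (n + 1)))⁻¹

theorem continuous_invSqrt (n : ℕ) : Continuous (invSqrt n) := by
  unfold invSqrt
  refine Continuous.inv₀ (by fun_prop) fun r => ?_
  positivity

theorem invSqrt_mul_self {n : ℕ} {r : ℝ} (hr : 0 ≤ r) :
    invSqrt n r * r * invSqrt n r = r / (r + 1 / (n + 1)) := by
  have hpos : 0 < r + 1 / ((n : ℝ) + 1) := by positivity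
  have h := Real.sq_sqrt hpos.le
  unfold invSqrt
  rw [abs_of_nonneg hr, ← h, Real.sqrt_sq (Real.sqrt_nonneg _)]
  have hs := (Real.sqrt_pos.2 hpos).ne'
  field_simp

/-- A von Neumann algebraic version of "row rank equals column rank", by approximation of the
partial isometry of the polar decomposition of `X` with the
contractions `X (X*X + 1/(n+1))^{-1/2}`. -/
theorem dim_range_star_le (X : N) :
    dim τ ((star X : N) : H →L[ℂ] H).range ≤ dim τ (X : H →L[ℂ] H).range := by
  set A : H →L[ℂ] H := ((star X * X : N) : H →L[ℂ] H) with hA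
  have hA0 : 0 ≤ A := by
    have := star_mul_self_nonneg (X : H →L[ℂ] H)
    exact this
  have hAsa : IsSelfAdjoint A := hA0.isSelfAdjoint
  have hspec : ∀ r ∈ spectrum ℝ A, 0 ≤ r := fun r hr => spectrum_nonneg_of_nonneg hA0 hr
  have hAX : ∀ z, A z = 0 → (X : H →L[ℂ] H) z = 0 := by
    intro z hz
    have h := re_inner_star_mul_self X z
    rw [← hA, hz, inner_zero_left, map_zero] at h
    exact norm_eq_zero.1 (pow_eq_zero_iff two_ne_zero |>.1 h.symm)
  let k : ℕ → N := fun n => ⟨cfc (invSqrt n) A, cfc_mem _ _⟩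
  let f : ℕ → ℝ → ℝ := fun n r => invSqrt n r * r * invSqrt n r
  have hf : ∀ n, Continuous (f n) := fun n =>
    ((continuous_invSqrt n).mul continuous_id).mul (continuous_invSqrt n)
  have hfr : ∀ n, ∀ r ∈ spectrum ℝ A, f n r = r / (r + 1 / (n + 1)) := fun n r hr =>
    invSqrt_mul_self (hspec r hr)
  let c : ℕ → N := fun n => X * k n
  have hck : ∀ n, ((star (c n) * c n : N) : H →L[ℂ] H) = cfc (f n) A := by
    intro n
    have h1 : star (cfc (invSqrt n) A) = cfc (invSqrt n) A := (cfc_predicate (invSqrt n) A).star_eq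
    have h2 : cfc (f n) A = cfc (invSqrt n) A * A * cfc (invSqrt n) A := by
      rw [cfc_mul (fun r => invSqrt n r * r) (invSqrt n) A
        ((continuous_invSqrt n).mul continuous_id).continuousOn (continuous_invSqrt n).continuousOn,
        cfc_mul (invSqrt n) (fun r => r) A (continuous_invSqrt n).continuousOn
        continuous_id.continuousOn, cfc_id' ℝ A]
    rw [h2]
    change star ((X : H →L[ℂ] H) * cfc (invSqrt n) A) * ((X : H →L[ℂ] H) * cfc (invSqrt n) A) = _
    rw [star_mul, h1]
    change _ = cfc (invSqrt n) A * (star (X : H →L[ℂ] H) * X) * cfc (invSqrt n) A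
    simp only [mul_assoc]
  have hmono : Monotone fun n => star (c n) * c n := by
    intro m n hmn
    change ((star (c m) * c m : N) : H →L[ℂ] H) ≤ ((star (c n) * c n : N) : H →L[ℂ] H)
    rw [hck, hck]
    refine cfc_mono (fun r hr => ?_) (hf m).continuousOn (hf n).continuousOn
    have := hspec r hr
    rw [hfr m r hr, hfr n r hr]
    gcongr
  have hf1 : ∀ n, cfc (f n) A ≤ 1 := by
    intro n
    refine cfc_le_one _ _ fun r hr => ?_
    have := hspec r hr
    rw [hfr n r hr]
    refine div_le_one_of_le₀ ?_ (by positivity)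
    have : 0 ≤ 1 / ((n : ℝ) + 1) := by positivity
    linarith
  have hcx : ∀ n x, ‖(c n : H →L[ℂ] H) x‖ ≤ ‖x‖ := by
    intro n x
    have h := re_inner_le_of_le (hf1 n) x
    rw [← hck, re_inner_star_mul_self] at h
    change _ ≤ RCLike.re (inner ℂ x x) at h
    rw [inner_self_eq_norm_sq] at h
    exact le_of_sq_le_sq h (norm_nonneg x)
  have hc1 : ∀ n, ‖(c n : H →L[ℂ] H)‖ ≤ 1 := fun n =>
    ContinuousLinearMap.opNorm_le_bound _ zero_le_one fun x => by rw [one_mul]; exact hcx n x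
  have hp : proj ((star X : N) : H →L[ℂ] H).range ∈ N := (IsAffiliated.range _).proj_mem
  set p : H →L[ℂ] H := proj ((star X : N) : H →L[ℂ] H).range with hpdef
  have hcp : ∀ n x, (c n : H →L[ℂ] H) (p x) = (c n : H →L[ℂ] H) x := by
    intro n x
    have h0 : (X : H →L[ℂ] H) (x - p x) = 0 := by
      have := star_apply_eq_zero_iff.2 (sub_proj_apply_mem ((star X : N) : H →L[ℂ] H).range x)
      rwa [star_star] at this
    have hA0 : A (x - p x) = 0 := by
      change ((star X : N) : H →L[ℂ] H) ((X : H →L[ℂ] H) (x - p x)) = 0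
      rw [h0, map_zero]
    have hcomm : A (cfc (invSqrt n) A (x - p x)) = cfc (invSqrt n) A (A (x - p x)) :=
      DFunLike.congr_fun ((Commute.refl A).cfc_real (invSqrt n)).symm.eq _
    have h1 : (c n : H →L[ℂ] H) (x - p x) = 0 := hAX _ (by
      change A (cfc (invSqrt n) A (x - p x)) = 0
      rw [hcomm, hA0, map_zero])
    rw [map_sub, sub_eq_zero] at h1
    exact h1.symm
  -- `f_n(A) → 1` strongly on the closure of the range of `A`
  have hlim : ∀ y ∈ A.range.topologicalClosure, Tendsto (fun n => cfc (f n) A y) atTop (𝓝 y) := by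
    have hfn : ∀ n x, ‖cfc (f n) A x‖ ≤ ‖x‖ := by
      intro n x
      have h1 : ‖cfc (f n) A‖ ≤ 1 := by
        rw [← hck]
        change ‖star (c n : H →L[ℂ] H) * (c n : H →L[ℂ] H)‖ ≤ 1
        refine (norm_mul_le _ _).trans ?_
        rw [norm_star]
        exact mul_le_one₀ (hc1 n) (norm_nonneg _) (hc1 n)
      exact (ContinuousLinearMap.le_of_opNorm_le _ h1 x).trans_eq (one_mul _)
    have hAz : ∀ n z, ‖cfc (f n) A (A z) - A z‖ ≤ 1 / ((n : ℝ) + 1) * ‖z‖ := by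
      intro n z
      have h1 : cfc (f n) A * A - A = cfc (fun r => f n r * r - r) A := by
        rw [cfc_sub (fun r => f n r * r) (fun r => r) A
          ((hf n).mul continuous_id).continuousOn continuous_id.continuousOn,
          cfc_mul (f n) (fun r => r) A (hf n).continuousOn continuous_id.continuousOn, cfc_id' ℝ A]
      have h2 : ‖cfc (f n) A * A - A‖ ≤ 1 / ((n : ℝ) + 1) := by
        rw [h1]
        refine norm_cfc_le (by positivity) fun r hr => ?_
        have h0 := hspec r hr
        have hε : 0 < 1 / ((n : ℝ) + 1) := by positivity
        rw [hfr n r hr]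
        set ε := 1 / ((n : ℝ) + 1)
        have h3 : r / (r + ε) * r - r = -(ε * (r / (r + ε))) := by field_simp; ring
        rw [h3, norm_neg, Real.norm_of_nonneg (by positivity)]
        exact mul_le_of_le_one_right hε.le (div_le_one_of_le₀ (by linarith) (by positivity))
      exact ContinuousLinearMap.le_of_opNorm_le _ h2 z
    intro y hy
    rw [Metric.tendsto_atTop]
    intro δ hδ
    obtain ⟨_, ⟨z, rfl⟩, hz⟩ := Metric.mem_closure_iff.1 hy (δ / 3) (by positivity)
    have hz' : ‖y - A z‖ < δ / 3 := by rw [← dist_eq_norm]; exact hz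
    have ht : Tendsto (fun n : ℕ => 1 / ((n : ℝ) + 1) * ‖z‖) atTop (𝓝 0) := by
      have := (tendsto_one_div_add_atTop_nhds_zero_nat (𝕜 := ℝ)).mul_const ‖z‖
      rwa [zero_mul] at this
    obtain ⟨n₀, hn₀⟩ := (ht.eventually_lt_const (show 0 < δ / 3 by positivity)).exists_forall_of_atTop
    refine ⟨n₀, fun n hn => ?_⟩
    have h4 : cfc (f n) A y - y
        = cfc (f n) A (y - A z) + (cfc (f n) A (A z) - A z) - (y - A z) := by
      rw [map_sub]; abel
    rw [dist_eq_norm, h4]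
    calc _ ≤ ‖cfc (f n) A (y - A z)‖ + ‖cfc (f n) A (A z) - A z‖ + ‖y - A z‖ :=
          (norm_sub_le _ _).trans (add_le_add_left (norm_add_le _ _) _)
      _ < δ / 3 + δ / 3 + δ / 3 := by
          have := hfn n (y - A z)
          have := hAz n z
          have := hn₀ n hn
          linarith
      _ = δ := by ring
  have hrange : ∀ x, p x ∈ A.range.topologicalClosure := by
    intro x
    have hle : ((star X : N) : H →L[ℂ] H).range.topologicalClosure ≤ A.range.topologicalClosure := by
      rw [← Submodule.orthogonal_orthogonal_eq_closure, ← Submodule.orthogonal_orthogonal_eq_closure]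
      refine Submodule.orthogonal_le fun z hz => ?_
      have h1 : ((star (star X * X) : N) : H →L[ℂ] H) z = 0 := star_apply_eq_zero_iff.2 hz
      rw [star_mul, star_star] at h1
      have h2 := hAX z h1
      rw [← star_apply_eq_zero_iff, star_star]
      exact h2
    exact hle (proj_apply_mem _ x)
  have hlub : IsLUB (Set.range fun n => star (c n) * c n) (⟨p, hp⟩ : N) := by
    constructor
    · rintro _ ⟨n, rfl⟩
      refine le_of_re_inner_le (congrArg Subtype.val (IsSelfAdjoint.star_mul_self (c n)).star_eq)
        (isStarProjection_proj _).isSelfAdjoint fun x => ?_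
      change RCLike.re (inner ℂ (((star (c n) * c n : N) : H →L[ℂ] H) x) x) ≤
        RCLike.re (inner ℂ (p x) x)
      rw [re_inner_star_mul_self, hpdef, re_inner_proj, ← hcp]
      gcongr
      exact hcx n _
    · intro S hS
      have hSn : ∀ n, ((star (c n) * c n : N) : H →L[ℂ] H) ≤ (S : H →L[ℂ] H) := fun n => hS ⟨n, rfl⟩
      have hS0 : 0 ≤ (S : H →L[ℂ] H) := by
        have h0 : 0 ≤ star (c 0 : H →L[ℂ] H) * (c 0 : H →L[ℂ] H) := star_mul_self_nonneg _
        exact h0.trans (hSn 0)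
      refine le_of_re_inner_le (isStarProjection_proj _).isSelfAdjoint hS0.isSelfAdjoint fun x => ?_
      rw [re_inner_proj, ← hpdef]
      have ht : Tendsto (fun n => RCLike.re (inner ℂ (cfc (f n) A (p x)) (p x))) atTop
          (𝓝 (RCLike.re (inner ℂ (p x) (p x)))) :=
        (RCLike.continuous_re.tendsto _).comp ((hlim _ (hrange x)).inner tendsto_const_nhds)
      rw [inner_self_eq_norm_sq] at ht
      refine le_of_tendsto' ht fun n => ?_
      rw [← hck, re_inner_star_mul_self, hcp, ← re_inner_star_mul_self]
      exact re_inner_le_of_le (hSn n) x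
  have hτ := τ.normal _ _ (Set.range_nonempty _)
    (directedOn_range.2 hmono.directed_le) (by
      rintro _ ⟨n, rfl⟩
      have h0 : 0 ≤ star (c n : H →L[ℂ] H) * (c n : H →L[ℂ] H) := star_mul_self_nonneg _
      exact h0) hlub
  rw [dim_eq hp, dim_eq (IsAffiliated.range X).proj_mem]
  refine hτ.2 ?_
  rintro _ ⟨_, ⟨n, rfl⟩, rfl⟩
  change τ (star (c n) * c n) ≤ _
  rw [τ.map_star_mul_self]
  refine τ.mono ?_ ?_
  · have h0 : 0 ≤ (c n : H →L[ℂ] H) * star (c n : H →L[ℂ] H) := mul_star_self_nonneg _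
    exact h0
  · refine mul_star_self_le_proj (X := X) (c := c n) ?_ (hc1 n)
    rintro _ ⟨z, rfl⟩
    exact ⟨_, rfl⟩

theorem eq_zero_of_mem_orthogonal {S : Submodule ℂ H} {x : H} (hx : x ∈ S) (hx' : x ∈ Sᗮ) :
    x = 0 :=
  inner_self_eq_zero.1 ((Submodule.mem_orthogonal S x).1 hx' x hx)

/-- Comparison of subspaces: if no nonzero vector of `S` is mapped into the complement of `S'` by
the operator `T ∈ N`, then `S` is at most as large as `S'`. -/
theorem dim_le_dim {S S' : Submodule ℂ H} (hS : IsAffiliated N S) (hS' : IsAffiliated N S')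
    (hSc : IsClosed (S : Set H)) (T : N)
    (h : ∀ x ∈ S, (T : H →L[ℂ] H) x ∈ S'ᗮ → x = 0) : dim τ S ≤ dim τ S' := by
  let X : N := ⟨proj S', hS'.proj_mem⟩ * T * ⟨proj S, hS.proj_mem⟩
  have hX : ∀ x, (X : H →L[ℂ] H) x = proj S' ((T : H →L[ℂ] H) (proj S x)) := fun x => rfl
  refine (dim_mono hS (IsAffiliated.range (star X)) ?_).trans ((dim_range_star_le X).trans
    (dim_mono (IsAffiliated.range X) hS' ?_))
  · rw [← hSc.submodule_topologicalClosure_eq, ← Submodule.orthogonal_orthogonal_eq_closure,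
      ← Submodule.orthogonal_orthogonal_eq_closure]
    refine Submodule.orthogonal_le fun x hx => ?_
    rw [← star_apply_eq_zero_iff, star_star, hX, proj_apply_eq_zero_iff] at hx
    have hm := proj_apply_mem S x
    rw [hSc.submodule_topologicalClosure_eq] at hm
    exact proj_apply_eq_zero_iff.1 (h _ hm hx)
  · rintro _ ⟨z, rfl⟩
    exact proj_apply_mem S' _

theorem dim_bot : dim τ (⊥ : Submodule ℂ H) = 0 := by
  have h : proj (⊥ : Submodule ℂ H) = 0 := by
    ext x
    rw [zero_apply, proj_apply_eq_zero_iff, Submodule.bot_orthogonal_eq_top]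
    trivial
  have h0 := τ.map_smul 0 0 le_rfl
  rw [smul_zero, ENNReal.coe_zero, zero_mul] at h0
  rw [dim_eq IsAffiliated.bot.proj_mem, ← h0]
  congr 1
  exact Subtype.ext h

theorem dim_sup_le {S S' : Submodule ℂ H} (hS : IsAffiliated N S) (hS' : IsAffiliated N S') :
    dim τ (S ⊔ S') ≤ dim τ S + dim τ S' := by
  rw [← dim_topologicalClosure (S := S ⊔ S'), dim_eq_add hS (hS.sup hS').topologicalClosure
    (Submodule.isClosed_topologicalClosure _) (le_sup_left.trans (Submodule.le_topologicalClosure _))]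
  gcongr
  refine dim_le_dim ((hS.sup hS').topologicalClosure.inf hS.orthogonal) hS' ?_ 1 fun x hx hx' => ?_
  · exact (Submodule.isClosed_topologicalClosure _).inter (Submodule.isClosed_orthogonal _)
  · have h1 : x ∈ (S ⊔ S').topologicalClosureᗮ := by
      rw [Submodule.orthogonal_closure, ← Submodule.inf_orthogonal]
      exact ⟨hx.2, hx'⟩
    exact eq_zero_of_mem_orthogonal hx.1 h1

theorem dim_map_le {S : Submodule ℂ H} (hS : IsAffiliated N S) (T : N) :
    dim τ (S.map (T : H →L[ℂ] H).toLinearMap) ≤ dim τ S := by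
  rw [← dim_topologicalClosure]
  refine dim_le_dim (hS.map T).topologicalClosure hS (Submodule.isClosed_topologicalClosure _)
    (star T) fun x hx hx' => ?_
  have h1 : x ∈ (S.map (T : H →L[ℂ] H).toLinearMap).topologicalClosureᗮ := by
    rw [Submodule.orthogonal_closure, Submodule.mem_orthogonal]
    rintro _ ⟨z, hz, rfl⟩
    change inner ℂ ((T : H →L[ℂ] H) z) x = 0
    rw [← inner_apply_star]
    exact (Submodule.mem_orthogonal _ _).1 hx' z hz
  exact eq_zero_of_mem_orthogonal hx h1

/-! ### Finite subspaces and the Calkin norm -/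

/-- A subspace is `τ`-finite if it is affiliated with `N` and has finite dimension `τ[S]`. -/
structure IsFinite (τ : FNSTrace N) (S : Submodule ℂ H) : Prop where
  isAffiliated : IsAffiliated N S
  dim_lt_top : dim τ S < ∞

namespace IsFinite

theorem sup {S S' : Submodule ℂ H} (hS : IsFinite τ S) (hS' : IsFinite τ S') :
    IsFinite τ (S ⊔ S') where
  isAffiliated := hS.1.sup hS'.1
  dim_lt_top := (dim_sup_le hS.1 hS'.1).trans_lt (ENNReal.add_lt_top.2 ⟨hS.2, hS'.2⟩)

theorem map {S : Submodule ℂ H} (hS : IsFinite τ S) (T : N) :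
    IsFinite τ (S.map (T : H →L[ℂ] H).toLinearMap) where
  isAffiliated := hS.1.map T
  dim_lt_top := (dim_map_le hS.1 T).trans_lt hS.2

theorem bot : IsFinite τ (⊥ : Submodule ℂ H) where
  isAffiliated := IsAffiliated.bot
  dim_lt_top := by rw [dim_bot]; exact ENNReal.zero_lt_top

end IsFinite

theorem mem_orthogonal_map_iff {S : Submodule ℂ H} {T : N} {x : H} :
    x ∈ (S.map (T : H →L[ℂ] H).toLinearMap)ᗮ ↔ ((star T : N) : H →L[ℂ] H) x ∈ Sᗮ := by
  rw [Submodule.mem_orthogonal, Submodule.mem_orthogonal]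
  constructor
  · intro h u hu
    rw [inner_apply_star]
    exact h _ ⟨u, hu, rfl⟩
  · rintro h _ ⟨u, hu, rfl⟩
    change inner ℂ ((T : H →L[ℂ] H) u) x = 0
    rw [← inner_apply_star]
    exact h u hu

/-- The operators of `N` that vanish on the complement of a `τ`-finite subspace form a two-sided
ideal, which contains the `τ`-finite projections. -/
def finiteSupportIdeal (τ : FNSTrace N) : TwoSidedIdeal N :=
  TwoSidedIdeal.mk' {T : N | ∃ S, IsFinite τ S ∧ ∀ x ∈ Sᗮ, (T : H →L[ℂ] H) x = 0}
    ⟨⊥, IsFinite.bot, fun _ _ => rfl⟩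
    (by
      rintro a b ⟨S, hS, ha⟩ ⟨S', hS', hb⟩
      refine ⟨S ⊔ S', hS.sup hS', fun x hx => ?_⟩
      change (a : H →L[ℂ] H) x + (b : H →L[ℂ] H) x = 0
      rw [ha x (Submodule.orthogonal_le le_sup_left hx),
        hb x (Submodule.orthogonal_le le_sup_right hx), add_zero])
    (by
      rintro a ⟨S, hS, ha⟩
      refine ⟨S, hS, fun x hx => ?_⟩
      change -(a : H →L[ℂ] H) x = 0
      rw [ha x hx, neg_zero])
    (by
      rintro a b ⟨S, hS, hb⟩
      refine ⟨S, hS, fun x hx => ?_⟩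
      change (a : H →L[ℂ] H) ((b : H →L[ℂ] H) x) = 0
      rw [hb x hx, map_zero])
    (by
      rintro a b ⟨S, hS, ha⟩
      refine ⟨_, hS.map (star b), fun x hx => ?_⟩
      rw [mem_orthogonal_map_iff, star_star] at hx
      exact ha _ hx)

/-- An operator whose Calkin norm is less than `c` is bounded by `c` on the complement of a
`τ`-finite subspace. -/
theorem exists_isFinite_of_norm_calkinMap_lt {T : N} {c : ℝ} (h : ‖calkinMap τ T‖ < c) :
    ∃ S, IsFinite τ S ∧ ∀ x ∈ Sᗮ, ‖(T : H →L[ℂ] H) x‖ ≤ c * ‖x‖ := by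
  set δ := (c - ‖calkinMap τ T‖) / 2 with hδ
  have hδ0 : 0 < δ := by rw [hδ]; linarith
  obtain ⟨T', hT', hn⟩ := Submodule.Quotient.norm_mk_lt (S := compactIdeal τ) (calkinMap τ T) hδ0
  have hK : T - T' ∈ compactIdeal τ := by
    rw [← Ideal.Quotient.mk_eq_mk_iff_sub_mem]
    exact hT'.symm
  obtain ⟨K, hK, hd⟩ := Metric.mem_closure_iff.1 hK δ hδ0
  have hK' : K ∈ finiteSupportIdeal τ := by
    refine TwoSidedIdeal.span_le.2 ?_ (TwoSidedIdeal.mem_asIdeal.1 hK)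
    rintro p ⟨hp, hpτ⟩
    refine (TwoSidedIdeal.mem_mk' _ _ _ _ _ _ _).2
      ⟨(p : H →L[ℂ] H).range, ⟨IsAffiliated.range p, (dim_range hp).trans_lt hpτ⟩, fun x hx => ?_⟩
    rw [← proj_apply_eq_zero_iff, proj_range hp] at hx
    exact hx
  obtain ⟨S, hS, hKS⟩ := (TwoSidedIdeal.mem_mk' _ _ _ _ _ _ _).1 hK'
  refine ⟨S, hS, fun x hx => ?_⟩
  have h1 : (T : H →L[ℂ] H) x = ((T' + (T - T' - K) : N) : H →L[ℂ] H) x := by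
    have : T' + (T - T' - K) = T - K := by abel
    rw [this]
    change _ = (T : H →L[ℂ] H) x - (K : H →L[ℂ] H) x
    rw [hKS x hx, sub_zero]
  rw [h1]
  refine ContinuousLinearMap.le_of_opNorm_le _ ?_ x
  change ‖(T' + (T - T' - K) : N)‖ ≤ c
  rw [dist_eq_norm] at hd
  calc _ ≤ ‖T'‖ + ‖T - T' - K‖ := norm_add_le _ _
    _ ≤ (‖calkinMap τ T‖ + δ) + δ := add_le_add hn.le hd.le
    _ = c := by rw [hδ]; ring

/-! ### An index formula -/

theorem isClosed_map {M : Submodule ℂ H} (hM : IsClosed (M : Set H)) (T : H →L[ℂ] H) {c : ℝ}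
    (hc : 0 < c) (h : ∀ x ∈ M, c * ‖x‖ ≤ ‖T x‖) :
    IsClosed (M.map T.toLinearMap : Set H) := by
  have : CompleteSpace M := hM.completeSpace_coe
  have ha : AntilipschitzWith (Real.toNNReal c⁻¹) (T ∘L M.subtypeL) := by
    refine ContinuousLinearMap.antilipschitz_of_bound _ fun x => ?_
    rw [Real.coe_toNNReal _ (inv_nonneg.2 hc.le), inv_mul_eq_div, le_div_iff₀' hc]
    exact h x x.2
  have hr := ha.isClosed_range (T ∘L M.subtypeL).uniformContinuous
  convert hr using 1
  ext y
  constructor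
  · rintro ⟨x, hx, rfl⟩
    exact ⟨⟨x, hx⟩, rfl⟩
  · rintro ⟨x, rfl⟩
    exact ⟨x, x.2, rfl⟩

theorem apply_of_mem_range {p : N} (hp : IsStarProjection p) {x : H}
    (hx : x ∈ (p : H →L[ℂ] H).range) : (p : H →L[ℂ] H) x = x := by
  rw [← proj_range hp]
  exact proj_apply_of_mem hx

/-- Additivity of codimensions, for `A ≤ B ≤ C`. -/
theorem dim_inf_orthogonal_eq_add {A B C : Submodule ℂ H} (hA : IsAffiliated N A)
    (hB : IsAffiliated N B) (hC : IsAffiliated N C) (hAc : IsClosed (A : Set H))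
    (hCc : IsClosed (C : Set H)) (hAB : A ≤ B) (hBC : B ≤ C) :
    dim τ (C ⊓ Aᗮ) = dim τ (B ⊓ Aᗮ) + dim τ (C ⊓ Bᗮ) := by
  have h : C ⊓ Bᗮ = (C ⊓ Aᗮ) ⊓ (B ⊓ Aᗮ)ᗮ := by
    refine le_antisymm (fun x hx => ⟨⟨hx.1, Submodule.orthogonal_le hAB hx.2⟩,
      Submodule.orthogonal_le inf_le_left hx.2⟩) (fun x hx => ⟨hx.1.1, ?_⟩)
    change x ∈ Bᗮ
    rw [Submodule.mem_orthogonal]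
    intro b hb
    have hbA : proj A b ∈ A := by
      have := proj_apply_mem A b
      rwa [hAc.submodule_topologicalClosure_eq] at this
    have h2 := (Submodule.mem_orthogonal _ _).1 hx.2 _
      ⟨B.sub_mem hb (hAB hbA), sub_proj_apply_mem A b⟩
    have h3 := (Submodule.mem_orthogonal _ _).1 hx.1.2 _ hbA
    rwa [inner_sub_left, h3, sub_zero] at h2
  rw [h]
  exact dim_eq_add (hB.inf hA.orthogonal) (hC.inf hA.orthogonal)
    (hCc.inter (Submodule.isClosed_orthogonal _)) (inf_le_inf_right _ hBC)

/-- If `T ∈ P N Q` is bounded below on a closed subspace `M` of `Q(H)`, and if `M` and `T(M)` have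
finite codimension in `Q(H)` and in `P(H)`, then `T` is Fredholm and its index is the difference
of the two codimensions. -/
theorem isFredholm_and_index_eq {P Q T : N} (hP : IsStarProjection P) (hQ : IsStarProjection Q)
    (hT : P * T * Q = T) {M : Submodule ℂ H} (hM : IsAffiliated N M) (hMc : IsClosed (M : Set H))
    (hMQ : M ≤ (Q : H →L[ℂ] H).range) {c : ℝ} (hc : 0 < c)
    (hb : ∀ x ∈ M, c * ‖x‖ ≤ ‖(T : H →L[ℂ] H) x‖)
    (h₁ : dim τ ((Q : H →L[ℂ] H).range ⊓ Mᗮ) < ∞)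
    (h₂ : dim τ ((P : H →L[ℂ] H).range ⊓ (M.map (T : H →L[ℂ] H).toLinearMap)ᗮ) < ∞) :
    IsFredholm τ P Q T ∧ index τ P Q T = (dim τ ((Q : H →L[ℂ] H).range ⊓ Mᗮ)).toReal -
      (dim τ ((P : H →L[ℂ] H).range ⊓ (M.map (T : H →L[ℂ] H).toLinearMap)ᗮ)).toReal := by
  have hPT : ∀ x, (T : H →L[ℂ] H) x ∈ (P : H →L[ℂ] H).range := by
    intro x
    refine ⟨(T : H →L[ℂ] H) x, ?_⟩
    have h : P * T = T := by
      conv_lhs => rw [← hT]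
      rw [← mul_assoc, ← mul_assoc, hP.isIdempotentElem.eq, hT]
    exact DFunLike.congr_fun (congrArg Subtype.val h) x
  set TM := M.map (T : H →L[ℂ] H).toLinearMap
  set R := (T : H →L[ℂ] H).range.topologicalClosure with hR
  set K := (T : H →L[ℂ] H).ker ⊓ (Q : H →L[ℂ] H).range
  set K' := ((star T : N) : H →L[ℂ] H).ker ⊓ (P : H →L[ℂ] H).range with hK'
  have hTMc : IsClosed (TM : Set H) := isClosed_map hMc _ hc hb
  have hTMa : IsAffiliated N TM := hM.map T
  have hQc := isClosed_range hQ
  have hPc := isClosed_range hP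
  have hQa := IsAffiliated.range Q
  have hPa := IsAffiliated.range P
  have hRa : IsAffiliated N R := (IsAffiliated.range T).topologicalClosure
  have hRc : IsClosed (R : Set H) := Submodule.isClosed_topologicalClosure _
  have hKa : IsAffiliated N K := (IsAffiliated.ker T).inf hQa
  have hTMR : TM ≤ R := by
    refine le_trans ?_ (Submodule.le_topologicalClosure _)
    rintro _ ⟨z, _, rfl⟩
    exact ⟨z, rfl⟩
  have hRP : R ≤ (P : H →L[ℂ] H).range := by
    refine Submodule.topologicalClosure_minimal _ ?_ hPc
    rintro _ ⟨z, rfl⟩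
    exact hPT z
  have hinj : ∀ x ∈ M, (T : H →L[ℂ] H) x = 0 → x = 0 := by
    intro x hx h0
    have h := hb x hx
    rw [h0, norm_zero] at h
    exact norm_le_zero_iff.1 (by nlinarith [norm_nonneg x])
  -- `L = ker T + M`, written in such a way that it is visibly closed
  set L := (Q : H →L[ℂ] H).range ⊓ TM.comap (T : H →L[ℂ] H).toLinearMap
  have hLa : IsAffiliated N L := hQa.inf (hTMa.comap T)
  have hLc : IsClosed (L : Set H) := hQc.inter (hTMc.preimage (T : H →L[ℂ] H).continuous)
  have hML : M ≤ L := fun x hx => ⟨hMQ hx, x, hx, rfl⟩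
  have hKL : K ≤ L := by
    rintro x ⟨hx, hxQ⟩
    refine ⟨hxQ, ?_⟩
    have hx0 : (T : H →L[ℂ] H) x = 0 := hx
    change (T : H →L[ℂ] H) x ∈ TM
    rw [hx0]; exact TM.zero_mem
  have hLQ : L ≤ (Q : H →L[ℂ] H).range := inf_le_left
  have hdimL : dim τ (L ⊓ Mᗮ) = dim τ K := by
    refine le_antisymm (dim_le_dim (hLa.inf hM.orthogonal) hKa
      (hLc.inter (Submodule.isClosed_orthogonal _)) 1 ?_)
      (dim_le_dim hKa (hLa.inf hM.orthogonal) ?_ 1 ?_)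
    · rintro x ⟨⟨hxQ, m, hm, hxm⟩, hxM⟩ hxK
      have hxm' : (T : H →L[ℂ] H) m = (T : H →L[ℂ] H) x := hxm
      have h1 : x - m ∈ K := by
        refine ⟨?_, Submodule.sub_mem _ hxQ (hMQ hm)⟩
        change (T : H →L[ℂ] H) (x - m) = 0
        rw [map_sub, hxm', sub_self]
      have h2 : inner ℂ (x - m) x = 0 := (Submodule.mem_orthogonal _ _).1 hxK _ h1
      have h3 : inner ℂ m x = 0 := (Submodule.mem_orthogonal _ _).1 hxM _ hm
      rw [inner_sub_left, h3, sub_zero] at h2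
      exact inner_self_eq_zero.1 h2
    · exact (isClosed_singleton.preimage (T : H →L[ℂ] H).continuous).inter hQc
    · intro x hx hx'
      exact hinj x (mem_of_forall_inner_eq_zero hMc hML (hKL hx) hx') hx.1
  have hdimR : dim τ (R ⊓ TMᗮ) = dim τ ((Q : H →L[ℂ] H).range ⊓ Lᗮ) := by
    have hZa := hRa.inf hTMa.orthogonal
    have hWa := hQa.inf hLa.orthogonal
    refine le_antisymm
      (dim_le_dim hZa hWa (hRc.inter (Submodule.isClosed_orthogonal _)) (star T) ?_)
      (dim_le_dim hWa hZa (hQc.inter (Submodule.isClosed_orthogonal _)) T ?_)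
    · rintro z ⟨hzR, hzM⟩ hz
      have hzL : ((star T : N) : H →L[ℂ] H) z ∈ Lᗮ := by
        rw [Submodule.mem_orthogonal]
        rintro l ⟨-, hl⟩
        rw [inner_apply_star]
        exact (Submodule.mem_orthogonal _ _).1 hzM _ hl
      have hzQ : ((star T : N) : H →L[ℂ] H) z ∈ (Q : H →L[ℂ] H).range := by
        refine ⟨((star T : N) : H →L[ℂ] H) z, ?_⟩
        have h : Q * star T = star T := by
          conv_rhs => rw [← hT]
          conv_lhs => rw [← hT]
          rw [star_mul, star_mul, hQ.isSelfAdjoint.star_eq, ← mul_assoc, hQ.isIdempotentElem.eq]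
        exact DFunLike.congr_fun (congrArg Subtype.val h) z
      have h0 : ((star T : N) : H →L[ℂ] H) z = 0 := eq_zero_of_mem_orthogonal
        (mem_of_forall_inner_eq_zero hLc hLQ hzQ hz) hzL
      have h1 := star_apply_eq_zero_iff.1 h0
      rw [← Submodule.orthogonal_closure] at h1
      exact eq_zero_of_mem_orthogonal hzR h1
    · rintro w ⟨hwQ, hwL⟩ hw
      have hwR : (T : H →L[ℂ] H) w ∈ R := Submodule.le_topologicalClosure _ ⟨w, rfl⟩
      have hwL' : w ∈ L := ⟨hwQ, mem_of_forall_inner_eq_zero hTMc hTMR hwR hw⟩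
      exact eq_zero_of_mem_orthogonal hwL' hwL
  have hsumQ : dim τ ((Q : H →L[ℂ] H).range ⊓ Mᗮ)
      = dim τ K + dim τ ((Q : H →L[ℂ] H).range ⊓ Lᗮ) := by
    rw [dim_inf_orthogonal_eq_add hM hLa hQa hMc hQc hML hLQ, hdimL]
  have hK'R : K' = (P : H →L[ℂ] H).range ⊓ Rᗮ := by
    rw [hK', inf_comm, hR, Submodule.orthogonal_closure]
    congr 1
    ext x
    exact star_apply_eq_zero_iff
  have hsumP : dim τ ((P : H →L[ℂ] H).range ⊓ TMᗮ)
      = dim τ K' + dim τ ((Q : H →L[ℂ] H).range ⊓ Lᗮ) := by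
    rw [dim_inf_orthogonal_eq_add hTMa hRa hPa hTMc hPc hTMR hRP, hdimR, hK'R, add_comm]
  have hkQ : τ (kerProj Q T) = dim τ K := (dim_eq hKa.proj_mem).symm
  have hkP : τ (kerProj P (star T)) = dim τ K' :=
    (dim_eq ((IsAffiliated.ker (star T)).inf hPa).proj_mem).symm
  rw [hsumQ] at h₁
  rw [hsumP] at h₂
  rw [ENNReal.add_lt_top] at h₁ h₂
  refine ⟨⟨hT, hkQ ▸ h₁.1, hkP ▸ h₂.1, ⟨proj TM, hTMa.proj_mem⟩, ?_, ?_, ?_, ?_⟩, ?_⟩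
  · have h := isStarProjection_proj TM
    exact ⟨Subtype.ext h.isIdempotentElem.eq, Subtype.ext h.isSelfAdjoint.star_eq⟩
  · change proj TM ≤ (P : H →L[ℂ] H)
    rw [← proj_range hP]
    exact proj_mono ((hTMR.trans hRP).trans (Submodule.le_topologicalClosure _))
  · have h : P - ⟨proj TM, hTMa.proj_mem⟩ =
        (⟨proj ((P : H →L[ℂ] H).range ⊓ TMᗮ), (hPa.inf hTMa.orthogonal).proj_mem⟩ : N) := by
      refine Subtype.ext ?_
      change (P : H →L[ℂ] H) - proj TM = _
      rw [sub_eq_iff_eq_add', ← proj_eq_add hPc (hTMR.trans hRP), proj_range hP]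
    rw [h, ← dim_eq, hsumP]
    exact ENNReal.add_lt_top.2 h₂
  · change (proj TM).range ≤ _
    rw [proj, Submodule.range_starProjection, hTMc.submodule_topologicalClosure_eq]
    rintro _ ⟨z, _, rfl⟩
    exact ⟨z, rfl⟩
  · rw [index, hkQ, hkP, hsumQ, hsumP, ENNReal.toReal_add h₁.1.ne h₁.2.ne,
      ENNReal.toReal_add h₂.1.ne h₂.2.ne]
    ring

/-! ### Essential codimension -/

theorem half_norm_le {P R : N} {x : H} (hx : (R : H →L[ℂ] H) x = x)
    (h : ‖(P : H →L[ℂ] H) x - (R : H →L[ℂ] H) x‖ ≤ 1 / 2 * ‖x‖) :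
    1 / 2 * ‖x‖ ≤ ‖(P : H →L[ℂ] H) x‖ := by
  rw [hx] at h
  have h1 := norm_sub_norm_le x (x - (P : H →L[ℂ] H) x)
  rw [sub_sub_cancel, norm_sub_rev x] at h1
  linarith

theorem inner_apply_eq_of_isStarProjection {P : N} (hP : IsStarProjection P) (x y : H) :
    inner ℂ ((P : H →L[ℂ] H) x) y = inner ℂ x ((P : H →L[ℂ] H) y) := by
  rw [← inner_star_apply, hP.isSelfAdjoint.star_eq]

theorem map_mul_eq_map {P R : N} (hR : IsStarProjection R) {M : Submodule ℂ H}
    (hMR : M ≤ (R : H →L[ℂ] H).range) :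
    M.map ((P * R : N) : H →L[ℂ] H).toLinearMap = M.map (P : H →L[ℂ] H).toLinearMap := by
  have h : ∀ x ∈ M, ((P * R : N) : H →L[ℂ] H) x = (P : H →L[ℂ] H) x := fun x hx =>
    congrArg (P : H →L[ℂ] H) (apply_of_mem_range hR (hMR hx))
  ext y
  constructor
  · rintro ⟨x, hx, rfl⟩
    exact ⟨x, hx, (h x hx).symm⟩
  · rintro ⟨x, hx, rfl⟩
    exact ⟨x, hx, h x hx⟩

/-- The index formula for the operator `P R` of two projections that are close to each other on
the complement of a `τ`-finite subspace. -/
theorem isFredholm_and_ec_eq {P R : N} (hP : IsStarProjection P) (hR : IsStarProjection R)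
    {S : Submodule ℂ H} (hS : IsFinite τ S)
    (hPR : ∀ x ∈ Sᗮ, ‖(P : H →L[ℂ] H) x - (R : H →L[ℂ] H) x‖ ≤ 1 / 2 * ‖x‖)
    {M : Submodule ℂ H} (hM : IsAffiliated N M) (hMc : IsClosed (M : Set H))
    (hMR : M ≤ (R : H →L[ℂ] H).range) (hMS : M ≤ Sᗮ)
    (h : dim τ ((R : H →L[ℂ] H).range ⊓ Mᗮ) < ∞) :
    dim τ ((P : H →L[ℂ] H).range ⊓ (M.map (P : H →L[ℂ] H).toLinearMap)ᗮ) < ∞ ∧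
    IsClosed (M.map (P : H →L[ℂ] H).toLinearMap : Set H) ∧
    IsFredholm τ P R (P * R) ∧
    ec τ P R = (dim τ ((R : H →L[ℂ] H).range ⊓ Mᗮ)).toReal -
      (dim τ ((P : H →L[ℂ] H).range ⊓ (M.map (P : H →L[ℂ] H).toLinearMap)ᗮ)).toReal := by
  have hb : ∀ x ∈ M, 1 / 2 * ‖x‖ ≤ ‖(P : H →L[ℂ] H) x‖ := fun x hx =>
    half_norm_le (apply_of_mem_range hR (hMR hx)) (hPR x (hMS hx))
  have hb' : ∀ x ∈ M, 1 / 2 * ‖x‖ ≤ ‖((P * R : N) : H →L[ℂ] H) x‖ := by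
    intro x hx
    change 1 / 2 * ‖x‖ ≤ ‖(P : H →L[ℂ] H) ((R : H →L[ℂ] H) x)‖
    rw [apply_of_mem_range hR (hMR hx)]
    exact hb x hx
  have hRa := IsAffiliated.range R
  have hdim : dim τ ((P : H →L[ℂ] H).range ⊓ (M.map (P : H →L[ℂ] H).toLinearMap)ᗮ) < ∞ := by
    have hfin : IsFinite τ ((R : H →L[ℂ] H).range ⊓ Mᗮ ⊔ S) :=
      IsFinite.sup ⟨hRa.inf hM.orthogonal, h⟩ hS
    refine (dim_le_dim ((IsAffiliated.range P).inf (hM.map P).orthogonal) hfin.1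
      ((isClosed_range hP).inter (Submodule.isClosed_orthogonal _)) 1 ?_).trans_lt hfin.2
    rintro x ⟨hxP, hxM⟩ hx
    have hxP' := apply_of_mem_range hP hxP
    rw [SetLike.mem_coe, mem_orthogonal_map_iff, hP.isSelfAdjoint.star_eq, hxP'] at hxM
    -- `R x` is orthogonal to `M` and to its complement in `R(H)`
    have hRM : (R : H →L[ℂ] H) x ∈ (R : H →L[ℂ] H).range ⊓ Mᗮ := by
      refine ⟨⟨x, rfl⟩, ?_⟩
      rw [SetLike.mem_coe, Submodule.mem_orthogonal]
      intro m hm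
      rw [← inner_apply_eq_of_isStarProjection hR, apply_of_mem_range hR (hMR hm)]
      exact (Submodule.mem_orthogonal _ _).1 hxM m hm
    have hRx : (R : H →L[ℂ] H) x = 0 := by
      refine eq_zero_of_mem_orthogonal hRM ?_
      rw [Submodule.mem_orthogonal]
      intro r hr
      rw [← inner_apply_eq_of_isStarProjection hR, apply_of_mem_range hR hr.1]
      exact (Submodule.mem_orthogonal _ _).1 hx r (Submodule.mem_sup_left hr)
    have hn := hPR x (Submodule.orthogonal_le le_sup_right hx)
    rw [hxP', hRx, sub_zero] at hn
    exact norm_le_zero_iff.1 (by linarith)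
  have hmap := map_mul_eq_map (P := P) hR hMR
  have key := isFredholm_and_index_eq (τ := τ) (T := P * R) hP hR
    (by rw [← mul_assoc, hP.isIdempotentElem.eq, mul_assoc, hR.isIdempotentElem.eq])
    hM hMc hMR one_half_pos hb' h (by rwa [hmap])
  rw [hmap] at key
  exact ⟨hdim, isClosed_map hMc _ one_half_pos hb, key⟩

theorem exists_isFinite_of_norm_sub_lt {P Q : N}
    (h : ‖calkinMap τ P - calkinMap τ Q‖ < 1 / 2) :
    ∃ S, IsFinite τ S ∧
      ∀ x ∈ Sᗮ, ‖(P : H →L[ℂ] H) x - (Q : H →L[ℂ] H) x‖ ≤ 1 / 2 * ‖x‖ := by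
  rw [← map_sub] at h
  exact exists_isFinite_of_norm_calkinMap_lt h

/-- Removing a `τ`-finite subspace from the range of a projection leaves a subspace of finite
codimension. -/
theorem dim_range_inf_lt_top {R : N} (hR : IsStarProjection R) {S : Submodule ℂ H}
    (hS : IsFinite τ S) :
    dim τ ((R : H →L[ℂ] H).range ⊓ ((R : H →L[ℂ] H).range ⊓ Sᗮ)ᗮ) < ∞ := by
  have hRa := IsAffiliated.range R
  refine (dim_le_dim (hRa.inf (hRa.inf hS.1.orthogonal).orthogonal) hS.1
    ((isClosed_range hR).inter (Submodule.isClosed_orthogonal _)) 1 ?_).trans_lt hS.2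
  rintro x ⟨hxR, hx⟩ hxS
  exact eq_zero_of_mem_orthogonal (S := (R : H →L[ℂ] H).range ⊓ Sᗮ) ⟨hxR, hxS⟩ hx

theorem isFredholm_mul {P Q : N} (hP : IsStarProjection P) (hQ : IsStarProjection Q)
    (h : ‖calkinMap τ P - calkinMap τ Q‖ < 1 / 2) : IsFredholm τ P Q (P * Q) := by
  obtain ⟨S, hS, hPQ⟩ := exists_isFinite_of_norm_sub_lt h
  exact (isFredholm_and_ec_eq hP hQ hS hPQ ((IsAffiliated.range Q).inf hS.1.orthogonal)
    ((isClosed_range hQ).inter (Submodule.isClosed_orthogonal _)) inf_le_left inf_le_right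
    (dim_range_inf_lt_top hQ hS)).2.2.1

/-- The cocycle identity of the essential codimension. On a subspace `M` of finite codimension in
`R(H)` the operators `P`, `Q` and `P Q` are bounded below, and `P(M)` and `P Q(M)` have the same
codimension in `P(H)`, because `P m` and `P Q m` are never orthogonal. -/
theorem ec_add_ec {P Q R : N} (hP : IsStarProjection P) (hQ : IsStarProjection Q)
    (hR : IsStarProjection R) (hPQ : ‖calkinMap τ P - calkinMap τ Q‖ < 1 / 2)
    (hQR : ‖calkinMap τ Q - calkinMap τ R‖ < 1 / 2)
    (hPR : ‖calkinMap τ P - calkinMap τ R‖ < 1 / 2) :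
    ec τ P Q + ec τ Q R = ec τ P R := by
  obtain ⟨S₁, hS₁, h₁⟩ := exists_isFinite_of_norm_sub_lt hPQ
  obtain ⟨S₂, hS₂, h₂⟩ := exists_isFinite_of_norm_sub_lt hQR
  obtain ⟨S₃, hS₃, h₃⟩ := exists_isFinite_of_norm_sub_lt hPR
  set S := S₁ ⊔ S₂ ⊔ S₃
  have hS : IsFinite τ S := (hS₁.sup hS₂).sup hS₃
  replace h₁ : ∀ x ∈ Sᗮ, ‖(P : H →L[ℂ] H) x - (Q : H →L[ℂ] H) x‖ ≤ 1 / 2 * ‖x‖ := fun x hx =>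
    h₁ x (Submodule.orthogonal_le (le_sup_left.trans le_sup_left) hx)
  replace h₂ : ∀ x ∈ Sᗮ, ‖(Q : H →L[ℂ] H) x - (R : H →L[ℂ] H) x‖ ≤ 1 / 2 * ‖x‖ := fun x hx =>
    h₂ x (Submodule.orthogonal_le (le_sup_right.trans le_sup_left) hx)
  replace h₃ : ∀ x ∈ Sᗮ, ‖(P : H →L[ℂ] H) x - (R : H →L[ℂ] H) x‖ ≤ 1 / 2 * ‖x‖ := fun x hx =>
    h₃ x (Submodule.orthogonal_le le_sup_right hx)
  -- `M` is chosen such that `M` and `Q(M)` are both orthogonal to `S`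
  set V := S ⊔ S.map (Q : H →L[ℂ] H).toLinearMap
  have hVf : IsFinite τ V := hS.sup (hS.map Q)
  set M := (R : H →L[ℂ] H).range ⊓ Vᗮ
  have hM : IsAffiliated N M := (IsAffiliated.range R).inf hVf.1.orthogonal
  have hMc : IsClosed (M : Set H) := (isClosed_range hR).inter (Submodule.isClosed_orthogonal _)
  have hMR : M ≤ (R : H →L[ℂ] H).range := inf_le_left
  have hMS : M ≤ Sᗮ := inf_le_right.trans (Submodule.orthogonal_le le_sup_left)
  have hQMS : M.map (Q : H →L[ℂ] H).toLinearMap ≤ Sᗮ := by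
    rintro _ ⟨x, hx, rfl⟩
    have h := Submodule.orthogonal_le le_sup_right hx.2
    rwa [mem_orthogonal_map_iff, hQ.isSelfAdjoint.star_eq] at h
  have hQMQ : M.map (Q : H →L[ℂ] H).toLinearMap ≤ (Q : H →L[ℂ] H).range := by
    rintro _ ⟨x, _, rfl⟩
    exact ⟨x, rfl⟩
  have hdim := dim_range_inf_lt_top hR hVf
  obtain ⟨-, hPMc, -, e₃⟩ := isFredholm_and_ec_eq hP hR hS h₃ hM hMc hMR hMS hdim
  obtain ⟨hd, hQMc, -, e₂⟩ := isFredholm_and_ec_eq hQ hR hS h₂ hM hMc hMR hMS hdim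
  obtain ⟨-, hPQMc, -, e₁⟩ := isFredholm_and_ec_eq hP hQ hS h₁ (hM.map Q) hQMc hQMQ hQMS hd
  -- `⟪P m, P Q m⟫ = ‖P m‖² - ⟪P m, P y⟫` for `y = m - Q m`, and `‖P y‖ ≤ ‖m‖/4 < ‖m‖/2 ≤ ‖P m‖`
  have hne : ∀ m ∈ M,
      inner ℂ ((P : H →L[ℂ] H) m) ((P : H →L[ℂ] H) ((Q : H →L[ℂ] H) m)) = 0 → m = 0 := by
    intro m hm h0
    have hRm := apply_of_mem_range hR (hMR hm)
    have hPm := half_norm_le hRm (h₃ m (hMS hm))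
    set y := m - (Q : H →L[ℂ] H) m with hy
    have hyS : y ∈ Sᗮ := Sᗮ.sub_mem (hMS hm) (hQMS ⟨m, hm, rfl⟩)
    have hQQ : (Q : H →L[ℂ] H) ((Q : H →L[ℂ] H) m) = (Q : H →L[ℂ] H) m :=
      apply_of_mem_range hQ ⟨m, rfl⟩
    have hQy : (Q : H →L[ℂ] H) y = 0 := by rw [hy, map_sub, hQQ, sub_self]
    have hyn : ‖y‖ ≤ 1 / 2 * ‖m‖ := by
      have h := h₂ m (hMS hm)
      rwa [hRm, norm_sub_rev] at h
    have hPy : ‖(P : H →L[ℂ] H) y‖ ≤ 1 / 2 * ‖y‖ := by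
      have h := h₁ y hyS
      rwa [hQy, sub_zero] at h
    have hQm : (Q : H →L[ℂ] H) m = m - y := by rw [hy]; abel
    rw [hQm, map_sub, inner_sub_right, sub_eq_zero, inner_self_eq_norm_sq_to_K] at h0
    have h1 : ‖(P : H →L[ℂ] H) m‖ ^ 2 ≤ ‖(P : H →L[ℂ] H) m‖ * ‖(P : H →L[ℂ] H) y‖ := by
      have h := norm_inner_le_norm (𝕜 := ℂ) ((P : H →L[ℂ] H) m) ((P : H →L[ℂ] H) y)
      rw [← h0] at h
      simpa using h
    by_contra hm0
    have hpos : 0 < ‖m‖ := norm_pos_iff.2 hm0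
    have hPpos : 0 < ‖(P : H →L[ℂ] H) m‖ := by linarith
    rw [sq] at h1
    have h2 := le_of_mul_le_mul_left h1 hPpos
    linarith
  have hcodim : dim τ ((P : H →L[ℂ] H).range ⊓ (M.map (P : H →L[ℂ] H).toLinearMap)ᗮ) =
      dim τ ((P : H →L[ℂ] H).range ⊓ ((M.map (Q : H →L[ℂ] H).toLinearMap).map
        (P : H →L[ℂ] H).toLinearMap)ᗮ) := by
    have hPa := IsAffiliated.range P
    have ha₁ := hPa.inf (hM.map P).orthogonal
    have ha₂ := hPa.inf ((hM.map Q).map P).orthogonal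
    have hPc := isClosed_range hP
    have hle₁ : M.map (P : H →L[ℂ] H).toLinearMap ≤ (P : H →L[ℂ] H).range := by
      rintro _ ⟨x, _, rfl⟩
      exact ⟨x, rfl⟩
    have hle₂ : (M.map (Q : H →L[ℂ] H).toLinearMap).map (P : H →L[ℂ] H).toLinearMap ≤
        (P : H →L[ℂ] H).range := by
      rintro _ ⟨x, _, rfl⟩
      exact ⟨x, rfl⟩
    refine le_antisymm
      (dim_le_dim ha₁ ha₂ (hPc.inter (Submodule.isClosed_orthogonal _)) 1 ?_)
      (dim_le_dim ha₂ ha₁ (hPc.inter (Submodule.isClosed_orthogonal _)) 1 ?_)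
    · rintro x ⟨hxP, hx⟩ hx'
      obtain ⟨_, ⟨m, hm, rfl⟩, rfl⟩ := mem_of_forall_inner_eq_zero hPQMc hle₂ hxP hx'
      have h0 := hne m hm ((Submodule.mem_orthogonal _ _).1 hx _ ⟨m, hm, rfl⟩)
      rw [h0, map_zero, map_zero]
    · rintro x ⟨hxP, hx⟩ hx'
      obtain ⟨m, hm, rfl⟩ := mem_of_forall_inner_eq_zero hPMc hle₁ hxP hx'
      have h0 := hne m hm (by
        rw [← inner_conj_symm, map_eq_zero]
        exact (Submodule.mem_orthogonal _ _).1 hx _ ⟨_, ⟨m, hm, rfl⟩, rfl⟩)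
      rw [h0, map_zero]
  rw [e₁, e₂, e₃, hcodim]
  ring

/-! ### Continuity of the spectral projection in the Calkin algebra -/

/-- An operator that is invertible modulo `𝓚` is bounded below on the complement of a `τ`-finite
subspace. -/
theorem exists_isFinite_bound_below {T : N} (hT : IsUnit (calkinMap τ T)) :
    ∃ S, IsFinite τ S ∧ ∃ c > 0, ∀ x ∈ Sᗮ, c * ‖x‖ ≤ ‖(T : H →L[ℂ] H) x‖ := by
  obtain ⟨b, hb⟩ := hT.exists_left_inv
  obtain ⟨B, rfl⟩ := Ideal.Quotient.mk_surjective b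
  have h0 : calkinMap τ (B * T - 1) = 0 := by
    rw [map_sub, map_mul, map_one, sub_eq_zero]
    exact hb
  obtain ⟨S, hS, h⟩ := exists_isFinite_of_norm_calkinMap_lt (τ := τ) (T := B * T - 1) (c := 1 / 2)
    (by rw [h0, norm_zero]; exact one_half_pos)
  have hB : 0 < ‖(B : H →L[ℂ] H)‖ + 1 := by positivity
  refine ⟨S, hS, (2 * (‖(B : H →L[ℂ] H)‖ + 1))⁻¹, by positivity, fun x hx => ?_⟩
  have h1 : ‖(B : H →L[ℂ] H) ((T : H →L[ℂ] H) x) - x‖ ≤ 1 / 2 * ‖x‖ := h x hx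
  have h2 := norm_sub_norm_le x (x - (B : H →L[ℂ] H) ((T : H →L[ℂ] H) x))
  rw [sub_sub_cancel, norm_sub_rev x] at h2
  have h3 := (B : H →L[ℂ] H).le_opNorm ((T : H →L[ℂ] H) x)
  rw [inv_mul_le_iff₀ (by positivity)]
  nlinarith [norm_nonneg ((T : H →L[ℂ] H) x)]

/-- A continuous function which is `0` on `(-∞, -δ]` and `1` on `[0, ∞)`. -/
def softStep (δ r : ℝ) : ℝ := 1 - max (-r) 0 / max δ (max (-r) 0)

theorem continuous_softStep {δ : ℝ} (hδ : 0 < δ) : Continuous (softStep δ) := by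
  unfold softStep
  refine continuous_const.sub (Continuous.div (by fun_prop) (by fun_prop) fun r => ?_)
  exact (lt_max_of_lt_left hδ).ne'

theorem abs_mul_negPart_mul_softStep_le {δ : ℝ} (hδ : 0 < δ) (r : ℝ) :
    |r * (max (-r) 0 * softStep δ r)| ≤ δ * |max (-r) 0 * softStep δ r| := by
  rw [abs_mul]
  rcases le_total 0 r with hr | hr
  · rw [max_eq_right (by linarith)]; simp
  · rcases le_total δ (-r) with h | h
    · have : softStep δ r = 0 := by
        unfold softStep
        rw [max_eq_left (by linarith : (0 : ℝ) ≤ -r), max_eq_right h,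
          div_self (by linarith), sub_self]
      rw [this]; simp
    · gcongr
      rw [abs_of_nonpos hr]; exact h

theorem norm_cfc_apply_le {T : H →L[ℂ] H} {h k : ℝ → ℝ} (hh : Continuous h)
    (hk : Continuous k) {δ : ℝ} (hδ : 0 ≤ δ) (hle : ∀ r, |k r| ≤ δ * |h r|) (x : H) :
    ‖cfc k T x‖ ≤ δ * ‖cfc h T x‖ := by
  have hsq : ∀ g : ℝ → ℝ, Continuous g →
      RCLike.re (inner ℂ (cfc (fun r => g r * g r) T x) x) = ‖cfc g T x‖ ^ 2 := by
    intro g hg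
    have hsa : IsSelfAdjoint (cfc g T) := cfc_predicate g T
    rw [cfc_mul g g T hg.continuousOn hg.continuousOn, ← inner_self_eq_norm_sq (𝕜 := ℂ)]
    exact congrArg RCLike.re (hsa.isSymmetric (cfc g T x) x)
  have hmono : cfc (fun r => k r * k r) T ≤ cfc (fun r => (δ * h r) * (δ * h r)) T := by
    refine cfc_mono (fun r _ => ?_) (hk.mul hk).continuousOn
      ((hh.const_mul δ).mul (hh.const_mul δ)).continuousOn
    rw [← abs_le_iff_mul_self_le, abs_mul, abs_of_nonneg hδ]
    exact hle r
  have h1 := re_inner_le_of_le hmono x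
  rw [hsq k hk, hsq (fun r => δ * h r) (hh.const_mul δ), cfc_const_mul δ h T hh.continuousOn] at h1
  have h2 := le_of_sq_le_sq h1 (norm_nonneg _)
  change _ ≤ ‖δ • cfc h T x‖ at h2
  rwa [norm_smul, Real.norm_of_nonneg hδ] at h2

/-- If `T` is bounded below by `c > δ` on the complement of a `τ`-finite subspace, then its spectral
subspace for `(-δ, 0)`, on which `f(T)` and `χ(T)` differ, is `τ`-finite. -/
theorem softStep_sub_chi_mem {T : N} (hT : IsSelfAdjoint T) {S : Submodule ℂ H}
    (hS : IsFinite τ S) {c δ : ℝ} (hδ : 0 < δ) (hδc : δ < c)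
    (hb : ∀ x ∈ Sᗮ, c * ‖x‖ ≤ ‖(T : H →L[ℂ] H) x‖) :
    (⟨cfc (softStep δ) (T : H →L[ℂ] H), cfc_mem T _⟩ : N) - chi T ∈ compactIdeal τ := by
  have hTs : IsSelfAdjoint (T : H →L[ℂ] H) := congrArg Subtype.val hT
  let neg : ℝ → ℝ := fun r => max (-r) 0
  let h : ℝ → ℝ := fun r => neg r * softStep δ r
  have hneg : Continuous neg := by fun_prop
  have hst := continuous_softStep hδ
  have hh : Continuous h := hneg.mul hst
  set T' := cfc neg (T : H →L[ℂ] H) with hT'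
  set F := cfc (softStep δ) (T : H →L[ℂ] H) with hF
  set G := cfc h (T : H →L[ℂ] H) with hG
  have hGN : G ∈ N := cfc_mem T h
  have hVa : IsAffiliated N G.range := IsAffiliated.range ⟨G, hGN⟩
  -- the spectral subspace of `T` for `(-δ, 0)` meets the complement of `S` trivially
  have hV : dim τ G.range < ∞ := by
    rw [← dim_topologicalClosure]
    refine (dim_le_dim hVa.topologicalClosure hS.1 (Submodule.isClosed_topologicalClosure _) 1
      fun x hx hxS => ?_).trans_lt hS.2
    have hcl : IsClosed {x : H | ‖(T : H →L[ℂ] H) x‖ ≤ δ * ‖x‖} :=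
      isClosed_le (by fun_prop) (by fun_prop)
    have h1 : ‖(T : H →L[ℂ] H) x‖ ≤ δ * ‖x‖ := by
      refine closure_minimal ?_ hcl hx
      rintro _ ⟨z, rfl⟩
      have h2 := norm_cfc_apply_le (T := (T : H →L[ℂ] H)) hh (k := fun r => r * h r)
        (continuous_id.mul hh) hδ.le
        (fun r => abs_mul_negPart_mul_softStep_le hδ r) z
      rw [cfc_mul (fun r => r) h _ continuous_id.continuousOn hh.continuousOn, cfc_id' ℝ _] at h2
      exact h2
    have h3 := hb x hxS
    by_contra hx0
    have := norm_pos_iff.2 hx0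
    nlinarith
  have hker : ∀ u, T' u = 0 → F u = u := by
    intro u hu
    let g : ℝ → ℝ := fun r => 1 / max δ (max (-r) 0)
    have hg : Continuous g := by
      refine Continuous.div (by fun_prop) (by fun_prop) fun r => ?_
      exact (lt_max_of_lt_left hδ).ne'
    have h1 : F = 1 - cfc g (T : H →L[ℂ] H) * T' := by
      rw [hT', ← cfc_mul g neg _ hg.continuousOn hneg.continuousOn, ← cfc_const_one ℝ (T : H →L[ℂ] H),
        ← cfc_sub (fun _ => 1) (fun r => g r * neg r) _ continuous_const.continuousOn
          (hg.mul hneg).continuousOn, hF]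
      congr 1
      ext r
      simp only [softStep, g, neg]
      ring
    rw [h1]
    change u - cfc g (T : H →L[ℂ] H) (T' u) = u
    rw [hu, map_zero, sub_zero]
  have hFT : F * T' = G := by
    rw [hF, hT', ← cfc_mul _ _ _ hst.continuousOn hneg.continuousOn, hG]
    congr 1
    ext r
    exact mul_comm _ _
  have hkerc : T'.ker.topologicalClosure = T'.ker := T'.isClosed_ker.submodule_topologicalClosure_eq
  have hmem : ∀ x, F x - proj T'.ker x ∈ G.range.topologicalClosure := by
    intro x
    have h1 : T' (proj T'.ker x) = 0 := by
      have := proj_apply_mem T'.ker x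
      rwa [hkerc] at this
    have h2 : F x - proj T'.ker x = F (x - proj T'.ker x) := by rw [map_sub, hker _ h1]
    have h3 : x - proj T'.ker x ∈ T'.range.topologicalClosure := by
      have hsa : ContinuousLinearMap.adjoint T' = T' :=
        (cfc_predicate neg (T : H →L[ℂ] H)).star_eq
      rw [← Submodule.orthogonal_orthogonal_eq_closure, ContinuousLinearMap.orthogonal_range, hsa]
      exact sub_proj_apply_mem _ x
    rw [h2]
    refine map_mem_closure F.continuous h3 ?_
    rintro _ ⟨z, rfl⟩
    exact ⟨z, (DFunLike.congr_fun hFT z).symm⟩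
  -- the difference factors through the finite projection onto the closure of the range of `G`
  have hA : (⟨F, cfc_mem T _⟩ : N) - chi T =
      (⟨proj G.range, hVa.proj_mem⟩ : N) * (⟨F, cfc_mem T _⟩ - chi T) := by
    refine Subtype.ext (ContinuousLinearMap.ext fun x => ?_)
    change F x - proj T'.ker x = proj G.range (F x - proj T'.ker x)
    exact (Submodule.starProjection_eq_self_iff.2 (hmem x)).symm
  rw [hA]
  refine Ideal.mul_mem_right _ _ (subset_closure ?_)
  refine TwoSidedIdeal.mem_asIdeal.2 (TwoSidedIdeal.subset_span ⟨?_, ?_⟩)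
  · have h := isStarProjection_proj G.range
    exact ⟨Subtype.ext h.isIdempotentElem.eq, Subtype.ext h.isSelfAdjoint.star_eq⟩
  · rw [← dim_eq]; exact hV

theorem continuous_calkinMap : Continuous (calkinMap τ) :=
  AddMonoidHomClass.continuous_of_bound (calkinMap τ) 1 fun x => by
    rw [one_mul]; exact Submodule.Quotient.norm_mk_le _ x

/-- `T ↦ π(χ(T))` is continuous: near a given `T₀`, all `π(χ(T))` are equal to `π(f(T))` for one
and the same continuous function `f`. -/
theorem continuous_calkinMap_chi :
    Continuous fun T : selfAdjointFredholm τ => calkinMap τ (chi (T : N)) := by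
  rw [continuous_iff_continuousAt]
  intro T₀
  obtain ⟨S, hS, c, hc, hb⟩ := exists_isFinite_bound_below T₀.2.2
  have hcont : Continuous fun T : selfAdjointFredholm τ =>
      calkinMap τ ⟨cfc (softStep (c / 2)) ((T : N) : H →L[ℂ] H), cfc_mem (T : N) _⟩ := by
    refine continuous_calkinMap.comp (Continuous.subtype_mk ?_ _)
    exact Continuous.cfc_of_mem_nhdsSet (𝕜 := ℝ) (s := Set.univ) _ Filter.univ_mem
      (continuous_subtype_val.comp continuous_subtype_val)
      (fun T => congrArg Subtype.val T.2.1) (continuous_softStep (half_pos hc)).continuousOn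
  refine hcont.continuousAt.congr ?_
  filter_upwards [Metric.ball_mem_nhds T₀ (show 0 < c / 3 by positivity)] with T hT
  refine (Ideal.Quotient.mk_eq_mk_iff_sub_mem _ _).2 (softStep_sub_chi_mem T.2.1 hS (half_pos hc)
    (show c / 2 < 2 * c / 3 by linarith) fun x hx => ?_)
  have hT' : ‖((T : N) : H →L[ℂ] H) - ((T₀ : N) : H →L[ℂ] H)‖ ≤ c / 3 := by
    have h := (Metric.mem_ball.1 hT).le
    rw [Subtype.dist_eq, dist_eq_norm] at h
    exact h
  have h1 := ContinuousLinearMap.le_of_opNorm_le _ hT' x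
  rw [sub_apply] at h1
  have h2 := hb x hx
  have h3 := norm_sub_norm_le (((T₀ : N) : H →L[ℂ] H) x) (((T : N) : H →L[ℂ] H) x)
  rw [norm_sub_rev] at h3
  linarith

/-! ### Independence of the partition -/

theorem isStarProjection_chi (T : N) : IsStarProjection (chi T) := by
  have h := isStarProjection_proj (cfc (fun r : ℝ => max (-r) 0) (T : H →L[ℂ] H)).ker
  exact ⟨Subtype.ext h.isIdempotentElem.eq, Subtype.ext h.isSelfAdjoint.star_eq⟩

/-- The condition under which the essential codimensions of spectral projections are used. -/
def IsClose (T T' : selfAdjointFredholm τ) : Prop :=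
  ‖calkinMap τ (chi (T : N)) - calkinMap τ (chi (T' : N))‖ < 1 / 2

/-- The essential codimension `ec(χ(T), χ(T'))`. -/
def chiEc (T T' : selfAdjointFredholm τ) : ℝ := ec τ (chi (T : N)) (chi (T' : N))

theorem chiEc_add_chiEc {T T' T'' : selfAdjointFredholm τ} (h : IsClose T T')
    (h' : IsClose T' T'') (h'' : IsClose T T'') : chiEc T T' + chiEc T' T'' = chiEc T T'' :=
  ec_add_ec (isStarProjection_chi _) (isStarProjection_chi _) (isStarProjection_chi _) h h' h''

theorem chiEc_self (T : selfAdjointFredholm τ) : chiEc T T = 0 := by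
  have h : IsClose T T := by
    rw [IsClose, sub_self, norm_zero]; exact one_half_pos
  have := chiEc_add_chiEc h h h
  linarith

variable {B₀ B₁ : selfAdjointFredholm τ} {B : Path B₀ B₁}

namespace Partition

theorem k_pos (p : Partition τ B) : 0 < p.k := by
  by_contra h
  have h0 : Fin.last p.k = 0 := Fin.ext (by simp; omega)
  have h1 := p.last
  rw [h0, p.first] at h1
  exact zero_ne_one h1

theorem exists_mem_Icc (p : Partition τ B) (s : unitInterval) :
    ∃ j : Fin p.k, s ∈ Set.Icc (p.t j.castSucc) (p.t j.succ) := by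
  have h : ∀ i : Fin (p.k + 1),
      (∃ j : Fin p.k, s ∈ Set.Icc (p.t j.castSucc) (p.t j.succ)) ∨ p.t i ≤ s := by
    intro i
    induction i using Fin.induction with
    | zero => right; rw [p.first]; exact unitInterval.nonneg'
    | succ i ih =>
      rcases ih with ih | ih
      · exact Or.inl ih
      · rcases le_total s (p.t i.succ) with h | h
        · exact Or.inl ⟨i, ih, h⟩
        · exact Or.inr h
  rcases h (Fin.last p.k) with h | h
  · exact h
  · have hk := p.k_pos
    refine ⟨⟨p.k - 1, by omega⟩, ?_, ?_⟩
    · exact (p.strictMono.monotone (Fin.le_last _)).trans h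
    · have hl : (⟨p.k - 1, by omega⟩ : Fin p.k).succ = Fin.last p.k := Fin.ext (by simp; omega)
      rw [hl, p.last]
      exact unitInterval.le_one'

/-- Points near `x` share a cell of the partition with `x`. -/
theorem eventually_exists_mem_Icc (p : Partition τ B) (x : unitInterval) :
    ∀ᶠ s in 𝓝 x, ∃ j : Fin p.k, s ∈ Set.Icc (p.t j.castSucc) (p.t j.succ) ∧
      x ∈ Set.Icc (p.t j.castSucc) (p.t j.succ) := by
  have h : ∀ᶠ s in 𝓝 x, ∀ j : Fin p.k, x ∉ Set.Icc (p.t j.castSucc) (p.t j.succ) →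
      s ∉ Set.Icc (p.t j.castSucc) (p.t j.succ) := by
    rw [eventually_all]
    intro j
    by_cases hx : x ∈ Set.Icc (p.t j.castSucc) (p.t j.succ)
    · exact Eventually.of_forall fun _ h => absurd hx h
    · filter_upwards [isClosed_Icc.isOpen_compl.mem_nhds hx] with s hs _ using hs
  filter_upwards [h] with s hs
  obtain ⟨j, hj⟩ := p.exists_mem_Icc s
  exact ⟨j, hj, by_contra fun hx => hs j hx hj⟩

/-- The sum of the essential codimensions along the partition, cut off at `s`. -/
def partialSum (p : Partition τ B) (s : unitInterval) : ℝ :=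
  ∑ i : Fin p.k, chiEc (B (min s (p.t i.castSucc))) (B (min s (p.t i.succ)))

theorem partialSum_sub (p : Partition τ B) {j : Fin p.k} {r s : unitInterval}
    (hr : r ∈ Set.Icc (p.t j.castSucc) (p.t j.succ))
    (hs : s ∈ Set.Icc (p.t j.castSucc) (p.t j.succ)) :
    p.partialSum s - p.partialSum r = chiEc (B r) (B s) := by
  have hm := p.strictMono.monotone
  rw [partialSum, partialSum, ← Finset.sum_sub_distrib, Finset.sum_eq_single j]
  · rw [min_eq_right hr.1, min_eq_right hs.1, min_eq_left hr.2, min_eq_left hs.2]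
    have hj : p.t j.castSucc ∈ Set.Icc (p.t j.castSucc) (p.t j.succ) :=
      ⟨le_rfl, hm (Fin.castSucc_le_succ j)⟩
    have h := chiEc_add_chiEc (T := B (p.t j.castSucc)) (T' := B r) (T'' := B s)
      (p.close j _ hj _ hr) (p.close j _ hr _ hs) (p.close j _ hj _ hs)
    linarith
  · intro i _ hij
    rcases lt_or_gt_of_ne hij with h | h
    · have h1 : p.t i.succ ≤ p.t j.castSucc := hm (Fin.succ_le_castSucc_iff.2 h)
      have h2 : p.t i.castSucc ≤ p.t i.succ := hm (Fin.castSucc_le_succ i)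
      rw [min_eq_right (h1.trans hs.1), min_eq_right (h1.trans hr.1),
        min_eq_right ((h2.trans h1).trans hs.1), min_eq_right ((h2.trans h1).trans hr.1), sub_self]
    · have h1 : p.t j.succ ≤ p.t i.castSucc := hm (Fin.succ_le_castSucc_iff.2 h)
      have h2 : p.t i.castSucc ≤ p.t i.succ := hm (Fin.castSucc_le_succ i)
      rw [min_eq_left (hs.2.trans h1), min_eq_left (hr.2.trans h1),
        min_eq_left ((hs.2.trans h1).trans h2), min_eq_left ((hr.2.trans h1).trans h2),
        chiEc_self, chiEc_self, sub_self]
  · intro h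
    exact absurd (Finset.mem_univ j) h

theorem partialSum_zero (p : Partition τ B) : p.partialSum 0 = 0 := by
  refine Finset.sum_eq_zero fun i _ => ?_
  rw [min_eq_left unitInterval.nonneg', min_eq_left unitInterval.nonneg', chiEc_self]

theorem partialSum_one (p : Partition τ B) : p.partialSum 1 = p.sumEc := by
  refine Finset.sum_congr rfl fun i _ => ?_
  rw [min_eq_right unitInterval.le_one', min_eq_right unitInterval.le_one']
  rfl

/-- The sum of the essential codimensions is independent of the partition: near each point the
partial sums of two partitions vary in the same way. -/
theorem sumEc_eq (p q : Partition τ B) : p.sumEc = q.sumEc := by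
  have h : IsLocallyConstant fun s => p.partialSum s - q.partialSum s := by
    rw [IsLocallyConstant.iff_eventually_eq]
    intro x
    filter_upwards [p.eventually_exists_mem_Icc x, q.eventually_exists_mem_Icc x]
      with s ⟨i, hsi, hxi⟩ ⟨j, hsj, hxj⟩
    have h1 := p.partialSum_sub hxi hsi
    have h2 := q.partialSum_sub hxj hsj
    linarith
  have h01 := h.apply_eq_of_preconnectedSpace 0 1
  simp only [partialSum_zero, partialSum_one] at h01
  linarith

end Partition

/-! ### Uniform partitions and homotopy invariance -/

/-- The points `i / (m + 1)` of the unit interval. -/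
def gridPoint (m i : ℕ) : unitInterval := Set.projIcc 0 1 zero_le_one ((i : ℝ) / (m + 1))

theorem coe_gridPoint {m i : ℕ} (hi : i ≤ m + 1) :
    (gridPoint m i : ℝ) = (i : ℝ) / (m + 1) := by
  have h : (i : ℝ) / (m + 1) ∈ Set.Icc (0 : ℝ) 1 := by
    refine ⟨by positivity, div_le_one_of_le₀ ?_ (by positivity)⟩
    exact_mod_cast hi
  rw [gridPoint, Set.projIcc_of_mem zero_le_one h]

theorem gridPoint_zero (m : ℕ) : gridPoint m 0 = 0 :=
  Subtype.ext (by rw [coe_gridPoint (Nat.zero_le _)]; simp)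

theorem gridPoint_last (m : ℕ) : gridPoint m (m + 1) = 1 :=
  Subtype.ext (by
    rw [coe_gridPoint le_rfl]
    push_cast
    exact div_self (by positivity))

/-- The partition of a path into `m + 1` intervals of equal length. -/
def uniformPartition (B : Path B₀ B₁) (m : ℕ)
    (h : ∀ r s : unitInterval, dist r s ≤ 1 / (m + 1) → IsClose (B r) (B s)) : Partition τ B where
  k := m + 1
  t i := gridPoint m i
  strictMono := by
    intro i j hij
    change (gridPoint m i : ℝ) < gridPoint m j
    rw [coe_gridPoint (by omega), coe_gridPoint (by omega)]
    have : (i : ℝ) < (j : ℝ) := by exact_mod_cast hij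
    gcongr
  first := gridPoint_zero m
  last := gridPoint_last m
  close := by
    intro i r hr s hs
    refine h r s ?_
    have h1 : ∀ x ∈ Set.Icc (gridPoint m i.castSucc) (gridPoint m i.succ),
        (x : ℝ) ∈ Set.Icc ((i : ℝ) / (m + 1)) (((i : ℝ) + 1) / (m + 1)) := by
      intro x hx
      have h2 : (gridPoint m i.castSucc : ℝ) ≤ x := hx.1
      have h3 : (x : ℝ) ≤ gridPoint m i.succ := hx.2
      rw [coe_gridPoint (by omega)] at h2 h3
      simpa using And.intro h2 h3
    refine (Real.dist_le_of_mem_Icc (h1 r hr) (h1 s hs)).trans_eq ?_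
    ring

/-- A continuous family of operators in `𝓕^{sa}` over a compact metric space has uniformly
continuous spectral projections modulo `𝓚`. -/
theorem exists_dist_le_imp_isClose {X : Type*} [PseudoMetricSpace X] [CompactSpace X]
    {F : X → selfAdjointFredholm τ} (hF : Continuous F) :
    ∃ m : ℕ, ∀ x y, dist x y ≤ 1 / ((m : ℝ) + 1) → IsClose (F x) (F y) := by
  have hu := CompactSpace.uniformContinuous_of_continuous
    ((continuous_calkinMap_chi (τ := τ)).comp hF)
  obtain ⟨δ, hδ, h⟩ := Metric.uniformContinuous_iff.1 hu (1 / 2) one_half_pos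
  obtain ⟨m, hm⟩ := exists_nat_one_div_lt hδ
  refine ⟨m, fun x y hxy => ?_⟩
  have := h (hxy.trans_lt hm)
  rwa [dist_eq_norm] at this

theorem wellDefined (B : Path B₀ B₁) : WellDefined τ B where
  exists_partition := by
    obtain ⟨m, hm⟩ := exists_dist_le_imp_isClose (τ := τ) B.continuous
    exact ⟨uniformPartition B m hm⟩
  fredholm p i := by
    refine isFredholm_mul (isStarProjection_chi _) (isStarProjection_chi _) ?_
    have hle : p.t i.castSucc ≤ p.t i.succ := p.strictMono.monotone (Fin.castSucc_le_succ i)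
    exact p.close i _ ⟨le_rfl, hle⟩ _ ⟨hle, le_rfl⟩
  sum_eq := Partition.sumEc_eq

theorem sf_eq_sumEc {B : Path B₀ B₁} (p : Partition τ B) : sf τ B = p.sumEc := by
  rw [sf, dif_pos ⟨p⟩]
  exact Partition.sumEc_eq _ p

/-- Along a homotopy the sum for a fixed fine uniform partition is locally constant: the cocycle
identity on the small squares of the grid makes the difference of two such sums telescope. -/
theorem sf_eq_of_homotopy {B B' : Path B₀ B₁} (F : Path.Homotopy B B') : sf τ B = sf τ B' := by
  obtain ⟨m, hm⟩ := exists_dist_le_imp_isClose (τ := τ) (F := fun x => F x) F.continuous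
  have hrow : ∀ t r s : unitInterval, dist r s ≤ 1 / ((m : ℝ) + 1) →
      IsClose (F (t, r)) (F (t, s)) := by
    intro t r s h
    refine hm (t, r) (t, s) ?_
    rw [Prod.dist_eq, dist_self]
    exact max_le (by positivity) h
  have hgrid : ∀ i ∈ Finset.range (m + 1),
      dist (gridPoint m i) (gridPoint m (i + 1)) ≤ 1 / ((m : ℝ) + 1) := by
    intro i hi
    rw [Finset.mem_range] at hi
    rw [Subtype.dist_eq, coe_gridPoint (by omega), coe_gridPoint (by omega), Real.dist_eq,
      abs_sub_comm]
    push_cast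
    rw [← sub_div, add_sub_cancel_left, abs_of_nonneg (by positivity)]
  have hsum : ∀ t, sf τ (F.eval t) = ∑ i ∈ Finset.range (m + 1),
      chiEc (F (t, gridPoint m i)) (F (t, gridPoint m (i + 1))) := by
    intro t
    rw [sf_eq_sumEc (uniformPartition (F.eval t) m (hrow t)), Finset.sum_range]
    rfl
  have hloc : IsLocallyConstant fun t => sf τ (F.eval t) := by
    rw [IsLocallyConstant.iff_eventually_eq]
    intro t
    filter_upwards [Metric.closedBall_mem_nhds t (show 0 < 1 / ((m : ℝ) + 1) by positivity)]
      with t' ht'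
    rw [Metric.mem_closedBall] at ht'
    have hclose : ∀ a b : unitInterval, dist a b ≤ 1 / ((m : ℝ) + 1) →
        IsClose (F (t', a)) (F (t, b)) := fun a b hab =>
      hm (t', a) (t, b) (by rw [Prod.dist_eq]; exact max_le ht' hab)
    have hself : ∀ a : unitInterval, dist a a ≤ 1 / ((m : ℝ) + 1) := fun a => by
      rw [dist_self]; positivity
    rw [← sub_eq_zero, hsum, hsum, ← Finset.sum_sub_distrib]
    have hterm : ∀ i ∈ Finset.range (m + 1),
        chiEc (F (t', gridPoint m i)) (F (t', gridPoint m (i + 1))) -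
          chiEc (F (t, gridPoint m i)) (F (t, gridPoint m (i + 1))) =
        chiEc (F (t', gridPoint m i)) (F (t, gridPoint m i)) -
          chiEc (F (t', gridPoint m (i + 1))) (F (t, gridPoint m (i + 1))) := by
      intro i hi
      have h1 := chiEc_add_chiEc (hrow t' _ _ (hgrid i hi)) (hclose _ _ (hself (gridPoint m (i + 1))))
        (hclose _ _ (hgrid i hi))
      have h2 := chiEc_add_chiEc (hclose _ _ (hself (gridPoint m i))) (hrow t _ _ (hgrid i hi))
        (hclose _ _ (hgrid i hi))
      linarith
    rw [Finset.sum_congr rfl hterm, Finset.sum_range_sub', gridPoint_zero, gridPoint_last]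
    simp only [Path.Homotopy.source, Path.Homotopy.target, chiEc_self, sub_self]
  have h := hloc.apply_eq_of_preconnectedSpace 0 1
  simpa only [Path.Homotopy.eval_zero, Path.Homotopy.eval_one] using h

end SpectralFlow
end

theorem proposition4p6 {H : Type*} [NormedAddCommGroup H] [InnerProductSpace ℂ H] [CompleteSpace H]
    [TopologicalSpace.SeparableSpace H] (N : VonNeumannAlgebra H) (τ : SpectralFlow.FNSTrace N)
    (B₀ B₁ : SpectralFlow.selfAdjointFredholm τ) (B B' : Path B₀ B₁)
    (hBB' : Path.Homotopic B B') :
    SpectralFlow.WellDefined τ B ∧ SpectralFlow.WellDefined τ B' ∧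
      SpectralFlow.sf τ B = SpectralFlow.sf τ B' := by
  obtain ⟨F⟩ := hBB'
  exact ⟨SpectralFlow.wellDefined B, SpectralFlow.wellDefined B', SpectralFlow.sf_eq_of_homotopy F⟩
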